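/- Let $G$ be a finite group and let $\sigma$ be an involution of the rational group algebra $\mathbb{Q}G$, i.e. an additive map with $\sigma(xy)=\sigma(y)\sigma(x)$ and $\sigma^2=\mathrm{id}$. For a ring $A$ with involution $\sigma$ write $A_\sigma^-=\{x\in A:\sigma(x)=-x\}$, and, when $A$ is a $\mathbb{Q}$-algebra, regard it as a Lie algebra over $\mathbb{Q}$ with bracket $[x,y]=xy-yx$. Let $\hat G$ be a complete list of the simple left $\mathbb{Q}G$-modules, one from each isomorphism class. For $V\in\hat G$ let $D=D_V$ be its division algebra of $\mathbb{Q}G$-endomorphisms (the opposite algebra, if $D$ is to act on the right), and let $Z=Z_V$ be the centre of $\mathrm{End}_D(V)$. Then $\hat G$ is finite, the action on the modules $V$ gives an isomorphism of $\mathbb{Q}$-algebras $$\mathbb{Q}G\;\simeq\;\bigoplus_{V\in\hat G}\mathrm{End}_D(V),$$ each block $\mathrm{End}_D(V)$ is simple with $\dim_Z\mathrm{End}_D(V)=n^2$ for an integer $n=n_V\ge 1$ (its degree), and for each $V$ there is exactly one $V^{op}\in\hat G$ with $\sigma(\mathrm{End}_D(V))=\mathrm{End}_{D'}(V^{op})$,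 where $D'=D_{V^{op}}$ and blocks are regarded as ideals of $\mathbb{Q}G$. (a) Suppose that $V^{op}=V$, so that $\sigma$ restricts to an involution of $\mathrm{End}_D(V)$, and put $F=\{z\in Z:\sigma(z)=z\}$. Call $V$ of orthogonal (respectively symplectic) type if $\sigma$ is the identity on $Z$ and, over some splitting field $L\supseteq Z$ of $\mathrm{End}_D(V)$, for some isomorphism of $L$-algebras $L\otimes_Z\mathrm{End}_D(V)\simeq\mathrm{End}_L(W)$, the involution $\mathrm{id}\otimes\sigma$ is the adjoint involution of a nonsingular symmetric (respectively skew-symmetric) bilinear form on $W$; call $V$ of unitary type if $\sigma$ is not the identity on $Z$. Then $V$ is of one of these types; the type is orthogonal if and only if $\dim_F\mathrm{End}_D(V)_\sigma^-=n(n-1)/2$, symplectic if and only if $\dim_F\mathrm{End}_D(V)_\sigma^-=n(n+1)/2$ and $n$ is even, and unitary if and only if $\dim_F\mathrm{End}_D(V)_\sigma^-=n^2$. (In the first two cases $F=Z$.) (b) Suppose that $V^{op}\ne V$. Then $\mathrm{End}_{D'}(V^{op})$ is isomorphic, as a ring, to the opposite ring of $\mathrm{End}_D(V)$, and it has the same degree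 $n$. Let $B=\mathrm{End}_D(V)\times\mathrm{End}_{D'}(V^{op})$ with the restriction of $\sigma$, and let $F$ be the ring of central elements of $B$ fixed by $\sigma$. The projection $B\to\mathrm{End}_D(V)$ maps $F$ bijectively onto $Z$ and $B_\sigma^-$ isomorphically, as a Lie algebra, onto $\mathrm{End}_D(V)$; and $\dim_F B_\sigma^-=n^2$. (c) Let $\mathfrak{o}(V)$, $\mathfrak{sp}(V)$ and $\mathfrak{gl}(V)$ denote the Lie algebra $\mathrm{End}_D(V)_\sigma^-$ for $V^{op}=V$ of orthogonal, symplectic and unitary type respectively, let $\mathfrak{gl}(V)$ also denote $B_\sigma^-$ in case (b), and let $\hat G_o$, $\hat G_{sp}$ and $\hat G_u$ be the corresponding subsets of $\hat G$ (the modules of case (b) belong to $\hat G_u$). Then, for every choice of one module from each pair $\{V,V^{op}\}$ with $V^{op}\neq V$, the projections to the blocks give an isomorphism of Lie algebras over $\mathbb{Q}$ $$\mathbb{Q}G_\sigma^-\;\simeq\;\bigoplus_{V\in\hat G_o}\mathfrak{o}(V)\;\oplus\;\bigoplus_{V\in\hat G_{sp}}\mathfrak{sp}(V)\;\oplus\;\bigoplus_{V\in\hat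 G_u}{}^{'}\mathfrak{gl}(V),$$ where the prime means that only the chosen module of each such pair $\{V,V^{op}\}$ contributes a summand. -/

import Mathlib

open scoped TensorProduct DirectSum

universe u

attribute [local instance 100] LieRing.ofAssociativeRing

namespace SkewGroupAlgebra

section Involution

/-!
### Rings with involution

An involution of a ring `R` is a `RingInvo R`: an additive, anti-multiplicative bijection of order
dividing two, written as a ring isomorphism `R ≃+* Rᵐᵒᵖ`.
-/

/-- The value `σ x ∈ R` of an involution `σ` of `R`. -/
abbrev app {R : Type*} [Ring R] (σ : RingInvo R) (x : R) : R := (σ x).unop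

theorem app_add {R : Type*} [Ring R] (σ : RingInvo R) (x y : R) :
    app σ (x + y) = app σ x + app σ y := by
  simp [app, map_add]

theorem app_mul {R : Type*} [Ring R] (σ : RingInvo R) (x y : R) :
    app σ (x * y) = app σ y * app σ x := by
  simp [app, map_mul]

theorem app_app {R : Type*} [Ring R] (σ : RingInvo R) (x : R) : app σ (app σ x) = x :=
  σ.involution x

theorem app_zero {R : Type*} [Ring R] (σ : RingInvo R) : app σ 0 = 0 := by simp [app]

theorem app_one {R : Type*} [Ring R] (σ : RingInvo R) : app σ 1 = 1 := by simp [app]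

theorem app_neg {R : Type*} [Ring R] (σ : RingInvo R) (x : R) : app σ (-x) = -app σ x := by
  simp [app, map_neg]

/-- An involution from a function with the three defining properties. -/
def ofFun {R : Type*} [Ring R] (f : R → R) (hadd : ∀ x y, f (x + y) = f x + f y)
    (hmul : ∀ x y, f (x * y) = f y * f x) (hinv : ∀ x, f (f x) = x) : RingInvo R where
  toFun x := MulOpposite.op (f x)
  invFun x := f x.unop
  left_inv x := hinv x
  right_inv x := by simp [hinv]
  map_mul' x y := by simp [hmul]
  map_add' x y := by simp [hadd]
  involution' x := hinv x

/-- Transport of an involution along a ring isomorphism `e : R ≃+* S`: the involution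
`e ∘ σ ∘ e⁻¹` of `S`. -/
def transport {R S : Type*} [Ring R] [Ring S] (e : R ≃+* S) (σ : RingInvo R) : RingInvo S :=
  ofFun (fun x => e (app σ (e.symm x)))
    (fun x y => by simp [app_add]) (fun x y => by simp [app_mul]) (fun x => by simp)

/-- The Lie algebra over `ℚ` of skew-symmetric elements `{x | σ x = -x}`, with the bracket
`⁅x, y⁆ = x * y - y * x`. -/
def skew {R : Type*} [Ring R] [Algebra ℚ R] (σ : RingInvo R) : LieSubalgebra ℚ R where
  carrier := {x | app σ x = -x}
  add_mem' {x y} hx hy := by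
    simp only [Set.mem_ofPred_eq] at *
    rw [app_add, hx, hy]; abel
  zero_mem' := by simp [app_zero]
  smul_mem' c x hx := by
    simp only [Set.mem_ofPred_eq] at *
    have h := map_rat_smul (AddMonoidHom.mk' (app σ) (app_add σ)) c x
    simp only [AddMonoidHom.mk'_apply] at h
    rw [h, hx, smul_neg]
  lie_mem' {x y} hx hy := by
    change app σ x = -x at hx
    change app σ y = -y at hy
    change app σ ⁅x, y⁆ = -⁅x, y⁆
    rw [Ring.lie_def, sub_eq_add_neg, app_add, app_neg, app_mul, app_mul, hx, hy]
    noncomm_ring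

/-- The subring `F = Z(R) ∩ {x | σ x = x}` of central symmetric elements. -/
def symCenter {R : Type*} [Ring R] (σ : RingInvo R) : Subring R where
  carrier := {x | x ∈ Subring.center R ∧ app σ x = x}
  mul_mem' {x y} hx hy := by
    refine ⟨mul_mem hx.1 hy.1, ?_⟩
    rw [app_mul, hx.2, hy.2]
    exact Subring.mem_center_iff.1 hx.1 y
  one_mem' := ⟨one_mem _, app_one σ⟩
  add_mem' {x y} hx hy := ⟨add_mem hx.1 hy.1, by rw [app_add, hx.2, hy.2]⟩
  zero_mem' := ⟨zero_mem _, app_zero σ⟩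
  neg_mem' {x} hx := ⟨neg_mem hx.1, by rw [app_neg, hx.2]⟩

/-- The skew-symmetric elements as a module over `F = Z(R) ∩ {x | σ x = x}`. -/
def skewModule {R : Type*} [Ring R] (σ : RingInvo R) : Submodule (symCenter σ) R where
  carrier := {x | app σ x = -x}
  add_mem' {x y} hx hy := by
    simp only [Set.mem_ofPred_eq] at *
    rw [app_add, hx, hy]; abel
  zero_mem' := by simp [app_zero]
  smul_mem' c x hx := by
    simp only [Set.mem_ofPred_eq] at *
    have hc : app σ (c : R) = c := c.2.2
    rw [Subring.smul_def, smul_eq_mul, app_mul, hx, hc, neg_mul,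
      Subring.mem_center_iff.1 c.2.1 x]

/-- The dimension over `F = Z(R) ∩ {x | σ x = x}` of the space of skew-symmetric elements. -/
noncomputable def skewDim {R : Type*} [Ring R] (σ : RingInvo R) : ℕ :=
  Module.finrank (symCenter σ) (skewModule σ)

/-- The dimension of `R` over its centre. -/
noncomputable def centerDim (R : Type*) [Ring R] : ℕ :=
  Module.finrank (Subring.center R) R

/-- `σ` is of the first kind: it fixes the centre elementwise, that is, `F = Z(R)`. -/
def IsFirstKind {R : Type*} [Ring R] (σ : RingInvo R) : Prop :=
  ∀ z ∈ Subring.center R, app σ z = z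

/-- Unitary type: `σ` is of the second kind, that is, not the identity on the centre. -/
def IsUnitaryType {R : Type*} [Ring R] (σ : RingInvo R) : Prop :=
  ¬ IsFirstKind σ

/-- Let `R` be central simple over its centre `Z`, and let `ε = ±1`. The involution `σ` is of the
first kind and, for some splitting field `L` of `R` and some isomorphism
`φ : L ⊗[Z] R ≃ End_L(W)`, the extended involution `id ⊗ σ` becomes the adjoint involution of a
nonsingular bilinear form `b` on `W` with `b y x = ε b x y`. (Both `id ⊗ σ` and the adjoint
involution are `L`-linear, so it is enough to compare them on the elements `1 ⊗ a`.) -/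
def IsAdjointOfSign {R : Type u} [Ring R] (σ : RingInvo R) (ε : ℤ) : Prop :=
  IsFirstKind σ ∧
  ∃ (L : Type u) (_ : Field L) (_ : Algebra (Subring.center R) L)
    (W : Type u) (_ : AddCommGroup W) (_ : Module L W) (_ : Module.Finite L W)
    (φ : (L ⊗[Subring.center R] R) ≃ₐ[L] Module.End L W) (b : LinearMap.BilinForm L W),
    b.Nondegenerate ∧ (∀ x y, b y x = ε • b x y) ∧
    ∀ (a : R) (x y : W), b x (φ (1 ⊗ₜ a) y) = b (φ (1 ⊗ₜ app σ a) x) y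

/-- Orthogonal type: over a splitting field, `σ` is adjoint to a symmetric bilinear form. -/
def IsOrthogonalType {R : Type u} [Ring R] (σ : RingInvo R) : Prop :=
  IsAdjointOfSign σ 1

/-- Symplectic type: over a splitting field, `σ` is adjoint to a skew-symmetric bilinear form. -/
def IsSymplecticType {R : Type u} [Ring R] (σ : RingInvo R) : Prop :=
  IsAdjointOfSign σ (-1)

end Involution

section Product

/-! ### Involutions of a product of rings -/

variable {ι : Type*} {A : ι → Type*} [∀ i, Ring (A i)]

/-- The factor `A i`, as a subset (two-sided ideal) of the product `∏ i, A i`. -/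
def factor (A : ι → Type*) [∀ i, Ring (A i)] (i : ι) : Set (∀ i, A i) :=
  {x | ∀ j, j ≠ i → x j = 0}

/-- `s (A i) = A j`. For `i = j` the factor `A i` is `s`-stable; for `i ≠ j` the factors
`A i` and `A j` are exchanged by `s`. -/
def Maps (s : RingInvo (∀ i, A i)) (i j : ι) : Prop :=
  app s '' factor A i = factor A j

theorem Maps.mem {s : RingInvo (∀ i, A i)} {i j : ι} (h : Maps s i j) {x : ∀ i, A i}
    (hx : x ∈ factor A i) : app s x ∈ factor A j :=
  h ▸ Set.mem_image_of_mem _ hx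

theorem Maps.symm {s : RingInvo (∀ i, A i)} {i j : ι} (h : Maps s i j) : Maps s j i := by
  unfold Maps at *
  rw [← h, ← Set.image_comp]
  convert Set.image_id _
  exact funext fun x => app_app s x

open Classical in
theorem single_mem_factor (i : ι) (a : A i) : Pi.single i a ∈ factor A i :=
  fun _ hj => Pi.single_eq_of_ne hj a

open Classical in
theorem single_apply_of_mem_factor {i : ι} {x : ∀ i, A i} (hx : x ∈ factor A i) :
    Pi.single i (x i) = x := by
  funext j
  by_cases hj : j = i
  · subst hj; simp
  · rw [Pi.single_eq_of_ne hj, hx j hj]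

open Classical in
/-- The restriction of `s` to an `s`-stable factor `A i`. -/
noncomputable def blockInvo (s : RingInvo (∀ i, A i)) {i : ι} (h : Maps s i i) : RingInvo (A i) :=
  ofFun (fun a => app s (Pi.single i a) i)
    (fun a b => by simp [Pi.single_add, app_add])
    (fun a b => by simp [Pi.single_mul, app_mul])
    (fun a => by
      rw [single_apply_of_mem_factor (h.mem (single_mem_factor i a)), app_app]; simp)

open Classical in
/-- The restriction of `s` to the product `A i × A j` of two distinct factors exchanged by `s`. -/
noncomputable def pairInvo (s : RingInvo (∀ i, A i)) {i j : ι} (h : Maps s i j) :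
    RingInvo (A i × A j) :=
  ofFun (fun a => (app s (Pi.single j a.2) i, app s (Pi.single i a.1) j))
    (fun a b => by ext <;> simp [Pi.single_add, app_add])
    (fun a b => by ext <;> simp [Pi.single_mul, app_mul])
    (fun a => by
      ext
      · simp only
        rw [single_apply_of_mem_factor (h.mem (single_mem_factor i a.1)), app_app]; simp
      · simp only
        rw [single_apply_of_mem_factor (h.symm.mem (single_mem_factor j a.2)), app_app]; simp)

/-- Indices of the stable factors on which `s` is of orthogonal type. -/
def orthogonalSet {A : ι → Type u} [∀ i, Ring (A i)] (s : RingInvo (∀ i, A i)) : Set ι :=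
  {i | ∃ h : Maps s i i, IsOrthogonalType (blockInvo s h)}

/-- Indices of the stable factors on which `s` is of symplectic type. -/
def symplecticSet {A : ι → Type u} [∀ i, Ring (A i)] (s : RingInvo (∀ i, A i)) : Set ι :=
  {i | ∃ h : Maps s i i, IsSymplecticType (blockInvo s h)}

/-- Indices of the stable factors on which `s` is of unitary type. -/
def unitarySet (s : RingInvo (∀ i, A i)) : Set ι :=
  {i | ∃ h : Maps s i i, IsUnitaryType (blockInvo s h)}

/-- The pairs of distinct factors exchanged by `s`, each written as `(i, j)` with `i ∈ T`. -/
def exchangedPairs (s : RingInvo (∀ i, A i)) (T : Set ι) : Set (ι × ι) :=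
  {p | p.1 ∈ T ∧ p.1 ≠ p.2 ∧ Maps s p.1 p.2}

/-- `T` contains exactly one index of every pair of distinct factors exchanged by `s`. -/
def SelectsOne (s : RingInvo (∀ i, A i)) (T : Set ι) : Prop :=
  ∀ i j, i ≠ j → Maps s i j → Xor (i ∈ T) (j ∈ T)

end Product

section Modules

/-- The division algebra of `R`-linear endomorphisms of a simple `R`-module `V`. (Acting on the
left of `V`, it is the opposite of the division algebra `D` acting on the right of `V`.) -/
abbrev D (R V : Type*) [Ring R] [AddCommGroup V] [Module R V] : Type _ := Module.End R V

/-- The algebra `End_D(V)` attached to a simple `R`-module `V`. -/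
abbrev EndD (R V : Type*) [Ring R] [AddCommGroup V] [Module R V] : Type _ :=
  Module.End (D R V) V

/-- `V` lists the simple `R`-modules, each isomorphism class exactly once. -/
structure IsCompleteListOfSimples (R : Type u) [Ring R] {ι : Type*} (V : ι → Type u)
    [∀ i, AddCommGroup (V i)] [∀ i, Module R (V i)] : Prop where
  simple : ∀ i, IsSimpleModule R (V i)
  eq_of_iso : ∀ i j, Nonempty (V i ≃ₗ[R] V j) → i = j
  complete : ∀ (W : Type u) [AddCommGroup W] [Module R W], IsSimpleModule R W →
    ∃ i, Nonempty (W ≃ₗ[R] V i)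

end Modules

end SkewGroupAlgebra

/-!
The action on the simple modules identifies a semisimple algebra with the product of its blocks.
An involution permutes the primitive central idempotents, hence the blocks, and an exchanged
pair is isomorphic to `A × Aᵐᵒᵖ` with the exchange involution, whose skew elements are the pairs
`(a, -a)`.

An involution of a block is governed by its action on the centre. If that action is trivial, then
over an algebraic closure the block becomes `End W`. The involution makes the dual of `W` a simple
`End W`-module, hence isomorphic to `W`, and such an isomorphism is a bilinear form for which the
involution is adjoint and which is symmetric or skew-symmetric. Its sign `ε` determines the trace
`ε n` of the involution, and therefore the dimension of its `-1`-eigenspace. If the action on the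
centre is not trivial, multiplication by a skew central element exchanges the two eigenspaces.
-/

namespace SkewGroupAlgebra

section AntiInvolution

/-- An anti-multiplicative self-inverse map. For `σ : RingInvo R` it is the map `app σ`; stated for
plain functions so that it also applies to linear maps over a field of scalars. -/
structure IsAntiInvolution {A : Type*} [Mul A] (s : A → A) : Prop where
  map_mul : ∀ x y, s (x * y) = s y * s x
  involutive : Function.Involutive s

theorem isAntiInvolution_app {R : Type*} [Ring R] (σ : RingInvo R) : IsAntiInvolution (app σ) :=
  ⟨app_mul σ, app_app σ⟩

theorem IsAntiInvolution.map_one {A : Type*} [MulOneClass A] {s : A → A}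
    (hs : IsAntiInvolution s) : s 1 = 1 := by
  have h := hs.map_mul 1 (s 1)
  rwa [one_mul, hs.involutive, one_mul, eq_comm] at h

theorem IsAntiInvolution.conj {A B : Type*} [Mul A] [Mul B] {s : A → A}
    (hs : IsAntiInvolution s) (e : A ≃* B) : IsAntiInvolution fun y => e (s (e.symm y)) :=
  ⟨fun x y => by simp [hs.map_mul], fun x => by simp [hs.involutive (e.symm x)]⟩

theorem IsAntiInvolution.baseChange {Z A : Type*} [CommRing Z] [Ring A] [Algebra Z A]
    {s : A →ₗ[Z] A} (hs : IsAntiInvolution s) (L : Type*) [CommRing L] [Algebra Z L] :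
    IsAntiInvolution (s.baseChange L) where
  map_mul t u := by
    induction t using TensorProduct.induction_on with
    | zero => simp
    | add t t' ht ht' => simp only [add_mul, mul_add, map_add, ht, ht']
    | tmul l a =>
      induction u using TensorProduct.induction_on with
      | zero => simp
      | add u u' hu hu' => simp only [add_mul, mul_add, map_add, hu, hu']
      | tmul l' a' => simp [hs.map_mul, mul_comm]
  involutive t := by
    rw [← LinearMap.comp_apply, ← LinearMap.baseChange_comp,
      show s ∘ₗ s = LinearMap.id from LinearMap.ext hs.involutive, LinearMap.baseChange_id,
      LinearMap.id_apply]

variable {K W : Type*} [Field K] [AddCommGroup W] [Module K W]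

/-- The map `τ`, read through the representation `ρ`, is the adjoint involution of the nonsingular
bilinear form `b` with `b y x = ε b x y`. -/
structure IsAdjointInvo {A : Type*} (ρ : A → Module.End K W) (τ : A → A)
    (b : LinearMap.BilinForm K W) (ε : ℤ) : Prop where
  nondegenerate : b.Nondegenerate
  symm : ∀ x y, b y x = ε • b x y
  adjoint : ∀ a x y, b x (ρ a y) = b (ρ (τ a) x) y

theorem dual_transpose_injective :
    Function.Injective (Module.Dual.transpose (R := K) (M := W) (M' := W)) := fun f g h =>
  LinearMap.ext fun x => sub_eq_zero.1 <| (Module.forall_dual_apply_eq_zero_iff K _).1 fun φ => by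
    simpa [Module.Dual.transpose_apply, sub_eq_zero] using congr($h φ x)

variable [FiniteDimensional K W]

/-- The anti-automorphism `τ` turns the dual of `W` into a second simple module over `End W`, which
must be isomorphic to `W`. -/
theorem exists_equiv_dual_of_antiInvolution {τ : Module.End K W →ₗ[K] Module.End K W}
    (hτ : IsAntiInvolution τ) :
    ∃ T : W ≃ₗ[K] Module.Dual K W, ∀ f x y, T (f x) y = T x (τ f y) := by
  let F : Module.End K W →ₐ[K] Module.End K (Module.Dual K W) :=
    AlgHom.ofLinearMap (Module.Dual.transpose ∘ₗ τ)
      (by ext; simp [hτ.map_one, Module.Dual.transpose_apply])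
      (fun f g => by ext; simp [hτ.map_mul, Module.Dual.transpose_apply])
  have hF_inj : Function.Injective F.toLinearMap :=
    dual_transpose_injective.comp hτ.involutive.injective
  have hfinrank : Module.finrank K (Module.End K W) =
      Module.finrank K (Module.End K (Module.Dual K W)) := by
    simp [Module.finrank_linearMap, Subspace.dual_finrank_eq]
  have hF : Function.Bijective F :=
    ⟨hF_inj, (LinearMap.injective_iff_surjective_of_finrank_eq_finrank
      (V := Module.End K W) (V₂ := Module.End K (Module.Dual K W)) hfinrank).1 hF_inj⟩
  obtain ⟨T, hT⟩ := (AlgEquiv.ofBijective F hF).eq_linearEquivConjAlgEquiv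
  refine ⟨T, fun f x y => ?_⟩
  have h : F f (T x) = T (f x) := by simpa using! congr($hT f (T x))
  rw [← h]
  rfl

/-- Both `T` and its transpose intertwine `f` with the transpose of `τ f`, so they differ by an
endomorphism that commutes with `End W`, that is, by a scalar. -/
theorem exists_flip_eq_smul_of_intertwines {τ : Module.End K W → Module.End K W}
    (hτ : Function.Involutive τ) (T : W ≃ₗ[K] Module.Dual K W)
    (hT : ∀ f x y, T (f x) y = T x (τ f y)) : ∃ k : K, ∀ x y, T y x = k * T x y := by
  let T' : W →ₗ[K] Module.Dual K W := T.toLinearMap.flip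
  let c : Module.End K W := T.symm.toLinearMap ∘ₗ T'
  have hTc : ∀ x, T (c x) = T' x := fun x => by simp [c]
  have hT' : ∀ f x y, T' (f x) y = T' x (τ f y) := fun f x y => by
    simp only [T', LinearMap.flip_apply, LinearEquiv.coe_coe, hT, hτ f]
  have hc : c ∈ Subalgebra.center K (Module.End K W) := Subalgebra.mem_center_iff.2 fun f => by
    ext x
    refine T.injective (LinearMap.ext fun y => ?_)
    simp only [Module.End.mul_apply, hT, hTc, hT']
  obtain ⟨k, hk⟩ := (Algebra.IsCentral.mem_center_iff K).1 hc
  refine ⟨k, fun x y => ?_⟩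
  have h : T' x y = T (c x) y := by rw [hTc]
  simpa [T', hk] using h

theorem exists_isAdjointInvo_of_antiInvolution [Nontrivial W]
    {τ : Module.End K W →ₗ[K] Module.End K W} (hτ : IsAntiInvolution τ) :
    ∃ (b : LinearMap.BilinForm K W) (ε : ℤ), (ε = 1 ∨ ε = -1) ∧ IsAdjointInvo id τ b ε := by
  obtain ⟨T, hT⟩ := exists_equiv_dual_of_antiInvolution hτ
  obtain ⟨k, hk⟩ := exists_flip_eq_smul_of_intertwines hτ.involutive T hT
  have hk_sq : k * k = 1 := by
    obtain ⟨x, hx⟩ := exists_ne (0 : W)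
    obtain ⟨y, hy⟩ : ∃ y, T x y ≠ 0 := by
      by_contra! h
      exact hx (T.map_eq_zero_iff.1 (LinearMap.ext h))
    have h := hk y x
    rw [hk x y, ← mul_assoc] at h
    exact (mul_eq_right₀ hy).1 h.symm
  have hadj : ∀ f x y, T x (f y) = T (τ f x) y := fun f x y => by rw [hT, hτ.involutive]
  have hnondeg : LinearMap.BilinForm.Nondegenerate (T : LinearMap.BilinForm K W) :=
    LinearMap.BilinForm.nondegenerate_iff_ker_eq_bot.2 T.ker
  rcases mul_self_eq_one_iff.1 hk_sq with rfl | rfl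
  · exact ⟨T, 1, .inl rfl, hnondeg, fun x y => by simpa using! hk x y, hadj⟩
  · exact ⟨T, -1, .inr rfl, hnondeg, fun x y => by simpa using! hk x y, hadj⟩

theorem trace_transpose (K : Type*) [CommRing K] (n : Type*) [Fintype n] :
    LinearMap.trace K (Matrix n n K) (Matrix.transposeLinearEquiv n n K K).toLinearMap =
      Fintype.card n := by
  classical
  have hdiag : ∀ i j : n, LinearMap.toMatrix (Matrix.stdBasis K n n) (Matrix.stdBasis K n n)
      (Matrix.transposeLinearEquiv n n K K).toLinearMap (i, j) (i, j) = if i = j then 1 else 0 := by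
    intro i j
    rw [LinearMap.toMatrix_apply, Matrix.stdBasis_eq_single]
    by_cases h : i = j
    · subst h; simp [Matrix.stdBasis]
    · simp [Matrix.stdBasis, h]
  rw [LinearMap.trace_eq_matrix_trace K (Matrix.stdBasis K n n), Matrix.trace,
    Fintype.sum_prod_type]
  simp [Matrix.diag_apply, hdiag, -Finset.sum_boole]

/-- Identifying `End W` with matrices through `f ↦ b (·) (f ·)`, an adjoint involution becomes `ε`
times the transpose. -/
theorem IsAdjointInvo.trace_eq {τ : Module.End K W →ₗ[K] Module.End K W}
    {b : LinearMap.BilinForm K W} {ε : ℤ} (h : IsAdjointInvo id τ b ε) :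
    LinearMap.trace K _ τ = ε * Module.finrank K W := by
  let v := Module.finBasis K W
  let T : W ≃ₗ[K] Module.Dual K W :=
    b.flip.toDual (LinearMap.BilinForm.nondegenerate_flip_iff.2 h.nondegenerate)
  let E : Module.End K W ≃ₗ[K] Matrix _ _ K :=
    (LinearEquiv.congrRight (M₂ := W) T).trans (LinearMap.BilinForm.toMatrix v)
  have hE : ∀ f i j, E f i j = b (v j) (f (v i)) := fun f i j => by
    simp [E, T]
    rfl
  have hconj : E.conj τ = (ε : K) • (Matrix.transposeLinearEquiv _ _ K K).toLinearMap := by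
    ext1 M
    obtain ⟨f, rfl⟩ := E.surjective M
    ext i j
    have hτ : b (v j) (τ f (v i)) = ε * b (v i) (f (v j)) := by
      rw [h.symm (τ f (v i)), ← id_eq (τ f), ← h.adjoint, zsmul_eq_mul, id_eq]
    simpa [LinearEquiv.conj_apply, hE] using hτ
  rw [← LinearMap.trace_conj' τ E, hconj, map_smul, trace_transpose, Fintype.card_fin, smul_eq_mul]

theorem even_finrank_of_nondegenerate_skew [CharZero K] {b : LinearMap.BilinForm K W}
    (hb : b.Nondegenerate) (hskew : ∀ x y, b y x = -b x y) : Even (Module.finrank K W) := by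
  let v := Module.finBasis K W
  let M := LinearMap.BilinForm.toMatrix v b
  have hM : M.det ≠ 0 := (LinearMap.BilinForm.nondegenerate_iff_det_ne_zero v).1 hb
  have hMT : M.transpose = -M := by
    ext i j
    simp [M, hskew (v i) (v j)]
  by_contra hodd
  have h := M.det_transpose
  rw [hMT, Matrix.det_neg, Fintype.card_fin, (Nat.not_even_iff_odd.1 hodd).neg_one_pow,
    neg_one_mul, neg_eq_self] at h
  exact hM h

end AntiInvolution

section CentralSimple

variable {Z A : Type*} [Field Z] [Ring A] [Algebra Z A]

section EnvelopingAlgebra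

attribute [local instance] TensorProduct.Algebra.module

theorem isSimpleModule_enveloping [IsSimpleRing A] : IsSimpleModule (A ⊗[Z] Aᵐᵒᵖ) A := by
  have hmul : ∀ (N : Submodule (A ⊗[Z] Aᵐᵒᵖ) A) (a x c : A), x ∈ N → a * x * c ∈ N :=
    fun N a x c hx => by
      simpa [TensorProduct.Algebra.smul_def, mul_assoc] using
        N.smul_mem (a ⊗ₜ MulOpposite.op c) hx
  refine (isSimpleModule_iff _ _).2 ⟨fun N => or_iff_not_imp_left.2 fun hN => ?_⟩
  obtain ⟨x, hx, hx_ne⟩ := N.exists_mem_ne_zero_of_ne_bot hN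
  let I : TwoSidedIdeal A := TwoSidedIdeal.mk' N N.zero_mem N.add_mem N.neg_mem
    (fun {a x} hx => by simpa using hmul N a x 1 hx)
    (fun {x a} hx => by simpa using hmul N 1 x a hx)
  have hI : ∀ y, y ∈ I ↔ y ∈ N := fun y => TwoSidedIdeal.mem_mk' _ _ _ _ _ _ _
  have hone : (1 : A) ∈ I := IsSimpleRing.one_mem_of_ne_zero_mem I hx_ne ((hI x).2 hx)
  exact eq_top_iff.2 fun a _ => by simpa using hmul N a 1 1 ((hI 1).1 hone)

theorem exists_eq_smul_of_enveloping_end [Algebra.IsCentral Z A]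
    (d : Module.End (A ⊗[Z] Aᵐᵒᵖ) A) : ∃ z : Z, ∀ x, d x = z • x := by
  have hd : ∀ a x c : A, d (a * x * c) = a * d x * c := fun a x c => by
    simpa [TensorProduct.Algebra.smul_def, mul_assoc] using
      d.map_smul (a ⊗ₜ MulOpposite.op c) x
  have hleft : ∀ x, d x = x * d 1 := fun x => by simpa using hd x 1 1
  have hright : ∀ x, d x = d 1 * x := fun x => by simpa using hd 1 1 x
  have hcenter : d 1 ∈ Subalgebra.center Z A :=
    Subalgebra.mem_center_iff.2 fun a => by rw [← hleft, ← hright]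
  obtain ⟨z, hz⟩ := (Algebra.IsCentral.mem_center_iff Z).1 hcenter
  exact ⟨z, fun x => by rw [hright, hz, Algebra.smul_def]⟩

/-- Jacobson density for `A` as a simple module over `A ⊗ Aᵒᵖ`. -/
theorem mulLeftRight_surjective [IsSimpleRing A] [Algebra.IsCentral Z A] [FiniteDimensional Z A] :
    Function.Surjective (AlgHom.mulLeftRight Z A) := by
  have := isSimpleModule_enveloping (Z := Z) (A := A)
  intro f
  let f' : Module.End (Module.End (A ⊗[Z] Aᵐᵒᵖ) A) A :=
    { f with
      map_smul' := fun d x => by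
        obtain ⟨z, hz⟩ := exists_eq_smul_of_enveloping_end d
        simp [hz] }
  classical
  let v := Module.finBasis Z A
  obtain ⟨t, ht⟩ := jacobson_density f' (Finset.univ.image v)
  exact ⟨t, v.ext fun i => (ht (v i) (by simp)).symm⟩

end EnvelopingAlgebra

variable (L : Type*) [Field L] [Algebra Z L]

theorem baseChange_mem_of_mem [IsSimpleRing A] [Algebra.IsCentral Z A] [FiniteDimensional Z A]
    {I : TwoSidedIdeal (L ⊗[Z] A)} {x : L ⊗[Z] A} (hx : x ∈ I) (f : A →ₗ[Z] A) :
    f.baseChange L x ∈ I := by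
  obtain ⟨t, rfl⟩ := mulLeftRight_surjective f
  induction t using TensorProduct.induction_on with
  | zero => simp
  | add s t hs ht =>
    rw [map_add, LinearMap.baseChange_add, LinearMap.add_apply]
    exact I.add_mem hs ht
  | tmul a c =>
    have h : ∀ y : L ⊗[Z] A, (AlgHom.mulLeftRight Z A (a ⊗ₜ c)).baseChange L y =
        (1 ⊗ₜ a) * y * (1 ⊗ₜ c.unop) := by
      intro y
      induction y using TensorProduct.induction_on with
      | zero => simp
      | add y z hy hz => rw [map_add, hy, hz, mul_add, add_mul]
      | tmul l y => simp
    rw [h]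
    exact I.mul_mem_right _ _ (I.mul_mem_left _ _ hx)

theorem baseChange_coord_smulRight {κ : Type*} (v : Module.Basis κ Z A) (k : κ) (x : L ⊗[Z] A) :
    ((v.coord k).smulRight (1 : A)).baseChange L x =
      algebraMap L (L ⊗[Z] A) ((v.baseChange L).repr x k) := by
  induction x using TensorProduct.induction_on with
  | zero => simp
  | add x y hx hy => rw [map_add, hx, hy, map_add, Finsupp.add_apply, map_add]
  | tmul l a =>
    rw [LinearMap.baseChange_tmul, LinearMap.smulRight_apply, ← TensorProduct.smul_tmul]
    simp [Algebra.TensorProduct.algebraMap_apply, Algebra.smul_def, mul_comm]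

theorem isSimpleRing_baseChange [IsSimpleRing A] [Algebra.IsCentral Z A] [FiniteDimensional Z A] :
    IsSimpleRing (L ⊗[Z] A) := by
  refine ⟨⟨fun I => or_iff_not_imp_left.2 fun hI => ?_⟩⟩
  obtain ⟨x, hx, hx_ne⟩ : ∃ x ∈ I, x ≠ 0 := by
    by_contra! h
    exact hI (le_bot_iff.1 fun y hy => by simp [h y hy])
  let v := Module.finBasis Z A
  obtain ⟨k, hk⟩ : ∃ k, (v.baseChange L).repr x k ≠ 0 := by
    by_contra! h
    exact hx_ne ((v.baseChange L).repr.map_eq_zero_iff.1 (Finsupp.ext h))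
  obtain ⟨u, hu⟩ : IsUnit (algebraMap L (L ⊗[Z] A) ((v.baseChange L).repr x k)) :=
    (isUnit_iff_ne_zero.2 hk).map _
  have hmem := baseChange_mem_of_mem L hx ((v.coord k).smulRight (1 : A))
  rw [baseChange_coord_smulRight, ← hu] at hmem
  exact eq_top_iff.2 fun y _ => by simpa using I.mul_mem_left (y * ↑u⁻¹) _ hmem

theorem exists_algEquiv_end_of_isAlgClosed [IsSimpleRing A] [Algebra.IsCentral Z A]
    [FiniteDimensional Z A] [IsAlgClosed L] :
    ∃ n : ℕ, 0 < n ∧ Nonempty ((L ⊗[Z] A) ≃ₐ[L] Module.End L (Fin n → L)) := by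
  have := isSimpleRing_baseChange (Z := Z) (A := A) L
  obtain ⟨n, hn, ⟨e⟩⟩ := IsSimpleRing.exists_algEquiv_matrix_of_isAlgClosed L (L ⊗[Z] A)
  exact ⟨n, Nat.pos_of_ne_zero hn.ne, ⟨e.trans Matrix.toLinAlgEquiv'⟩⟩

end CentralSimple

section Involutive

variable {K M : Type*} [Field K] [NeZero (2 : K)] [AddCommGroup M] [Module K M]

theorem two_mul_finrank_ker_add_one [FiniteDimensional K M] {s : Module.End K M}
    (hs : Function.Involutive s) :
    2 * (Module.finrank K (LinearMap.ker (s + 1)) : K) =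
      Module.finrank K M - LinearMap.trace K M s := by
  let p : Module.End K M := (2⁻¹ : K) • (1 - s)
  have hp : LinearMap.IsProj (LinearMap.ker (s + 1)) p := by
    refine ⟨fun x => by simp [p, hs x], fun x hx => ?_⟩
    have hsx : s x = -x := eq_neg_of_add_eq_zero_left (by simpa using hx)
    simp [p, hsx, ← two_smul K x, smul_smul, two_ne_zero]
  simp [← hp.trace, p, two_ne_zero]

/-- `m` exchanges the two eigenspaces of `s`. -/
theorem nonempty_ker_add_one_prod_equiv {s : Module.End K M} (hs : Function.Involutive s)
    (m : M ≃ₗ[K] M) (hm : ∀ x, s (m x) = -m (s x)) :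
    Nonempty ((LinearMap.ker (s + 1) × LinearMap.ker (s + 1)) ≃ₗ[K] M) := by
  have hker : ∀ {x : M}, x ∈ LinearMap.ker (s + 1) ↔ s x = -x := fun {x} => by
    simp [LinearMap.mem_ker, eq_neg_iff_add_eq_zero]
  have two_ne : (2 : K) ≠ 0 := two_ne_zero
  let f := (LinearMap.ker (s + 1)).subtype.coprod
    (m.toLinearMap ∘ₗ (LinearMap.ker (s + 1)).subtype)
  have hf_inj : Function.Injective f := by
    refine (injective_iff_map_eq_zero f).2 fun ⟨⟨x, hx⟩, ⟨y, hy⟩⟩ h => ?_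
    have hsum : x + m y = 0 := by simpa [f] using h
    have hdiff : m y - x = 0 := by
      simpa [hm, hker.1 hx, hker.1 hy, ← sub_eq_neg_add] using congr(s $hsum)
    have hx_eq : m y = x := sub_eq_zero.1 hdiff
    have hx_zero : x = 0 := by simpa [hx_eq, ← two_smul K x, two_ne] using hsum
    simp_all
  have hf_surj : Function.Surjective f := fun w => by
    let x := (2⁻¹ : K) • (w - s w)
    let y := m.symm ((2⁻¹ : K) • (w + s w))
    have hx : s x = -x := by simp [x, hs w, ← smul_neg]
    have hy : s y = -y := by
      refine m.injective (neg_injective ?_)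
      rw [← hm]
      simp [y, hs w, add_comm]
    refine ⟨(⟨x, hker.2 hx⟩, ⟨y, hker.2 hy⟩), ?_⟩
    simp [f, x, y, ← smul_add, ← two_smul K w, smul_smul, two_ne]
  exact ⟨.ofBijective f ⟨hf_inj, hf_surj⟩⟩

end Involutive

section AdjointDimension

variable {Z A L W : Type*} [Field Z] [Ring A] [Algebra Z A] [Field L] [Algebra Z L]
  [AddCommGroup W] [Module L W]

theorem IsAdjointInvo.baseChange {s : A →ₗ[Z] A} {φ : (L ⊗[Z] A) →ₐ[L] Module.End L W}
    {b : LinearMap.BilinForm L W} {ε : ℤ} (h : IsAdjointInvo (fun a => φ (1 ⊗ₜ a)) s b ε) :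
    IsAdjointInvo φ (s.baseChange L) b ε where
  nondegenerate := h.nondegenerate
  symm := h.symm
  adjoint t x y := by
    induction t using TensorProduct.induction_on with
    | zero => simp
    | add t u ht hu => simp only [map_add, LinearMap.add_apply, ht, hu]
    | tmul l a =>
      have hsmul : ∀ c : A, (l ⊗ₜ[Z] c : L ⊗[Z] A) = l • (1 ⊗ₜ c) := fun c => by
        simp [TensorProduct.smul_tmul']
      rw [LinearMap.baseChange_tmul, hsmul a, hsmul (s a), map_smul, map_smul]
      simp [h.adjoint]

variable [FiniteDimensional L W]

theorem finrank_eq_sq_of_algEquiv_end (φ : (L ⊗[Z] A) ≃ₐ[L] Module.End L W) :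
    Module.finrank Z A = Module.finrank L W ^ 2 := by
  rw [← Module.finrank_baseChange (R := L) (S := Z), φ.toLinearEquiv.finrank_eq,
    Module.finrank_linearMap, sq]

theorem IsAdjointInvo.two_mul_finrank_ker_add_one [CharZero Z] [FiniteDimensional Z A]
    {s : Module.End Z A} (hs : Function.Involutive s) {φ : (L ⊗[Z] A) ≃ₐ[L] Module.End L W}
    {b : LinearMap.BilinForm L W} {ε : ℤ}
    (h : IsAdjointInvo (fun a => φ (1 ⊗ₜ a)) s b ε) :
    2 * (Module.finrank Z (LinearMap.ker (s + 1)) : ℤ) =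
      (Module.finrank L W : ℤ) ^ 2 - ε * Module.finrank L W := by
  have : CharZero L := charZero_of_injective_algebraMap (algebraMap Z L).injective
  let τ : Module.End L W →ₗ[L] Module.End L W := φ.toLinearEquiv.conj (s.baseChange L)
  have hτ : IsAdjointInvo id τ b ε := ⟨h.nondegenerate, h.symm, fun f x y => by
    obtain ⟨t, rfl⟩ := φ.surjective f
    have hadjoint := (IsAdjointInvo.baseChange (φ := φ.toAlgHom) h).adjoint t x y
    simpa [τ, LinearEquiv.conj_apply] using hadjoint⟩
  have htrace : algebraMap Z L (LinearMap.trace Z A s) = ε * Module.finrank L W := by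
    rw [← LinearMap.trace_baseChange, ← LinearMap.trace_conj' _ φ.toLinearEquiv, hτ.trace_eq]
  have hfix := congrArg (algebraMap Z L) (SkewGroupAlgebra.two_mul_finrank_ker_add_one hs)
  rw [map_sub, htrace, finrank_eq_sq_of_algEquiv_end φ] at hfix
  apply Int.cast_injective (α := L)
  simpa [map_ofNat (algebraMap Z L)] using hfix

theorem exists_isAdjointInvo_of_algEquiv_end [Nontrivial W] {s : A →ₗ[Z] A}
    (hs : IsAntiInvolution s) (φ : (L ⊗[Z] A) ≃ₐ[L] Module.End L W) :
    ∃ (b : LinearMap.BilinForm L W) (ε : ℤ), (ε = 1 ∨ ε = -1) ∧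
      IsAdjointInvo (fun a => φ (1 ⊗ₜ a)) s b ε := by
  let τ : Module.End L W →ₗ[L] Module.End L W := φ.toLinearEquiv.conj (s.baseChange L)
  have hτ : IsAntiInvolution τ := (hs.baseChange L).conj φ.toMulEquiv
  obtain ⟨b, ε, hε, h⟩ := exists_isAdjointInvo_of_antiInvolution hτ
  refine ⟨b, ε, hε, h.nondegenerate, h.symm, fun a x y => ?_⟩
  simpa [τ, LinearEquiv.conj_apply] using h.adjoint (φ (1 ⊗ₜ a)) x y

end AdjointDimension

section SemilinearInvolution

variable {F Z M : Type*} [Field F] [NeZero (2 : F)] [Field Z] [Algebra F Z] [AddCommGroup M]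
  [Module F M] [Module Z M] [IsScalarTower F Z M]

theorem two_mul_finrank_ker_add_one_of_semilinear [FiniteDimensional F M] {t : Z →ₐ[F] Z}
    {s : Module.End F M} (hs : Function.Involutive s) (hst : ∀ a x, s (a • x) = t a • s x)
    {z : Z} (hz : z ≠ 0) (htz : t z = -z) :
    2 * Module.finrank F (LinearMap.ker (s + 1)) = Module.finrank F M := by
  obtain ⟨e⟩ := nonempty_ker_add_one_prod_equiv hs
    ((LinearEquiv.smulOfNeZero Z M z hz).restrictScalars F) fun x => by simp [hst, htz]
  rw [← e.finrank_eq, Module.finrank_prod, two_mul]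

theorem finrank_eq_two_of_involutive {t : Z →ₐ[F] Z} (ht : Function.Involutive t)
    (hfix : ∀ a, t a = a → a ∈ Set.range (algebraMap F Z)) {z : Z} (hz : z ≠ 0) (htz : t z = -z) :
    Module.finrank F Z = 2 := by
  let s : Module.End F Z := -t.toLinearMap
  have hs : Function.Involutive s := fun x => by simp [s, ht x]
  have hker : LinearMap.ker (s + 1) = LinearMap.range (Algebra.linearMap F Z) := by
    ext a
    simp only [s, LinearMap.mem_ker, LinearMap.add_apply, LinearMap.neg_apply,
      AlgHom.toLinearMap_apply, Module.End.one_apply, neg_add_eq_zero]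
    exact ⟨fun h => hfix a h, by rintro ⟨c, rfl⟩; exact t.commutes c⟩
  obtain ⟨e⟩ := nonempty_ker_add_one_prod_equiv hs
    ((LinearEquiv.smulOfNeZero Z Z z hz).restrictScalars F) fun x => by simp [s, htz]
  let j : F ≃ₗ[F] LinearMap.ker (s + 1) :=
    (LinearEquiv.ofInjective _ (algebraMap F Z).injective).trans (LinearEquiv.ofEq _ _ hker.symm)
  rw [← ((j.prodCongr j).trans e).finrank_eq, Module.finrank_prod, Module.finrank_self]

theorem finrank_ker_add_one_of_semilinear [FiniteDimensional Z M] {t : Z →ₐ[F] Z}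
    (ht : Function.Involutive t) (hfix : ∀ a, t a = a → a ∈ Set.range (algebraMap F Z))
    (hne : ∃ a, t a ≠ a) {s : Module.End F M} (hs : Function.Involutive s)
    (hst : ∀ a x, s (a • x) = t a • s x) :
    Module.finrank F (LinearMap.ker (s + 1)) = Module.finrank Z M := by
  obtain ⟨a, ha⟩ := hne
  have hz : a - t a ≠ 0 := sub_ne_zero.2 ha.symm
  have htz : t (a - t a) = -(a - t a) := by rw [map_sub, ht, neg_sub]
  have hZ : Module.finrank F Z = 2 := finrank_eq_two_of_involutive ht hfix hz htz
  have : FiniteDimensional F Z := Module.finite_of_finrank_eq_succ hZ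
  have : FiniteDimensional F M := Module.Finite.trans Z M
  have hM := two_mul_finrank_ker_add_one_of_semilinear hs hst hz htz
  rw [← Module.finrank_mul_finrank F Z M, hZ] at hM
  exact Nat.eq_of_mul_eq_mul_left two_pos hM

end SemilinearInvolution

section SimpleInvolution

theorem isCentral_center (R : Type*) [Ring R] : Algebra.IsCentral (Subring.center R) R :=
  ⟨fun x hx => Algebra.mem_bot.2 ⟨⟨x, Subring.mem_center_iff.2 fun y =>
    (Subalgebra.mem_center_iff.1 hx y)⟩, rfl⟩⟩

theorem exists_centerDim_eq_sq (R : Type*) [Ring R] [IsSimpleRing R]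
    [Module.Finite (Subring.center R) R] : ∃ n : ℕ, 0 < n ∧ centerDim R = n ^ 2 := by
  let := (IsSimpleRing.isField_center R).toField
  have := isCentral_center R
  obtain ⟨n, hn, ⟨φ⟩⟩ := exists_algEquiv_end_of_isAlgClosed (Z := Subring.center R) (A := R)
    (AlgebraicClosure (Subring.center R))
  exact ⟨n, hn, by rw [centerDim, finrank_eq_sq_of_algEquiv_end φ, Module.finrank_fin_fun]⟩

section AnyRing

variable {R : Type*} [Ring R] (σ : RingInvo R)

/-- An involution, as a map linear over a ring of central symmetric elements. -/
def invoLinearMap (S : Subring R) (hS : S ≤ symCenter σ) : R →ₗ[S] R where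
  toFun := app σ
  map_add' := app_add σ
  map_smul' c x := by
    have hc := hS c.2
    rw [Subring.smul_def, smul_eq_mul, app_mul, hc.2, Subring.mem_center_iff.1 hc.1]
    rfl

theorem isAntiInvolution_invoLinearMap (S : Subring R) (hS : S ≤ symCenter σ) :
    IsAntiInvolution (invoLinearMap σ S hS) :=
  isAntiInvolution_app σ

variable {σ}

theorem skewDim_eq_finrank_ker {S : Subring R} (hS : S = symCenter σ) :
    skewDim σ = Module.finrank S (LinearMap.ker
      (invoLinearMap σ S hS.le + 1 : Module.End S R)) := by
  subst hS
  have hker : skewModule σ = LinearMap.ker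
      (invoLinearMap σ (symCenter σ) le_rfl + 1 : Module.End (symCenter σ) R) := by
    ext x
    exact eq_neg_iff_add_eq_zero
  rw [skewDim, hker]

theorem IsFirstKind.center_eq_symCenter (h : IsFirstKind σ) : Subring.center R = symCenter σ :=
  le_antisymm (fun z hz => ⟨hz, h z hz⟩) fun _ hz => hz.1

variable (σ)

theorem app_mem_center {z : R} (hz : z ∈ Subring.center R) : app σ z ∈ Subring.center R :=
  Subring.mem_center_iff.2 fun x => by
    simpa only [app_mul, app_app] using
      congrArg (app σ) (Subring.mem_center_iff.1 hz (app σ x)).symm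

theorem isField_symCenter [IsSimpleRing R] : IsField (symCenter σ) where
  exists_pair_ne := ⟨0, 1, zero_ne_one⟩
  mul_comm x y := Subtype.ext (Subring.mem_center_iff.1 y.2.1 x)
  mul_inv_cancel := by
    rintro ⟨x, hx⟩ hx0
    obtain ⟨⟨y, hy⟩, hxy⟩ := (IsSimpleRing.isField_center R).mul_inv_cancel
      (a := ⟨x, hx.1⟩) fun h => hx0 (Subtype.ext congr(($h).1))
    replace hxy : x * y = 1 := congr(($hxy).1)
    have hσy : app σ y * x = 1 := by simpa only [app_mul, hx.2, app_one] using congrArg (app σ) hxy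
    exact ⟨⟨y, hy, left_inv_eq_right_inv hσy hxy⟩, Subtype.ext hxy⟩

end AnyRing

theorem IsUnitaryType.skewDim_eq {R : Type*} [Ring R] [IsSimpleRing R] [NeZero (2 : R)]
    [Module.Finite (Subring.center R) R] {σ : RingInvo R} (h : IsUnitaryType σ) :
    skewDim σ = centerDim R := by
  let := (IsSimpleRing.isField_center R).toField
  let := (isField_symCenter σ).toField
  have hle : symCenter σ ≤ Subring.center R := fun _ hx => hx.1
  let : Algebra (symCenter σ) (Subring.center R) := (Subring.inclusion hle).toAlgebra
  have : IsScalarTower (symCenter σ) (Subring.center R) R :=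
    ⟨fun x y z => mul_assoc (x : R) (y : R) z⟩
  have : NeZero (2 : symCenter σ) := ⟨fun h2 => two_ne_zero (α := R) congr(($h2).1)⟩
  let t : Subring.center R →ₐ[symCenter σ] Subring.center R :=
    { toFun := fun z => ⟨app σ z, app_mem_center σ z.2⟩
      map_one' := Subtype.ext (app_one σ)
      map_mul' := fun x y => Subtype.ext <| (app_mul σ x y).trans <|
        Subring.mem_center_iff.1 (app_mem_center σ x.2) _
      map_zero' := Subtype.ext (app_zero σ)
      map_add' := fun x y => Subtype.ext (app_add σ x y)
      commutes' := fun c => Subtype.ext c.2.2 }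
  rw [skewDim_eq_finrank_ker rfl, centerDim]
  refine finrank_ker_add_one_of_semilinear (t := t) (fun z => Subtype.ext (app_app σ z))
    (fun a ha => ⟨⟨a, a.2, congr(($ha).1)⟩, rfl⟩) ?_ (app_app σ) fun a x => ?_
  · by_contra! hfix
    exact h fun z hz => congr(($(hfix ⟨z, hz⟩)).1)
  · exact (app_mul σ a x).trans (Subring.mem_center_iff.1 (app_mem_center σ a.2) _)

theorem IsSymplecticType.even {R : Type u} [Ring R] [IsSimpleRing R] [CharZero R] {σ : RingInvo R}
    (h : IsSymplecticType σ) {n : ℕ} (hn : centerDim R = n ^ 2) : Even n := by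
  let := (IsSimpleRing.isField_center R).toField
  obtain ⟨-, L, _, _, W, _, _, _, φ, b, hb, hskew, -⟩ := h
  have : CharZero L := charZero_of_injective_algebraMap (algebraMap (Subring.center R) L).injective
  have hW : n = Module.finrank L W :=
    Nat.pow_left_injective two_ne_zero (hn.symm.trans (finrank_eq_sq_of_algEquiv_end φ))
  rw [hW]
  exact even_finrank_of_nondegenerate_skew hb fun x y => by simp [hskew x y]

variable {R : Type u} [Ring R] [IsSimpleRing R] [Module.Finite (Subring.center R) R]

theorem IsAdjointOfSign.two_mul_skewDim [CharZero R] {σ : RingInvo R} {ε : ℤ}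
    (h : IsAdjointOfSign σ ε) {n : ℕ} (hn : centerDim R = n ^ 2) :
    2 * (skewDim σ : ℤ) = (n : ℤ) ^ 2 - ε * n := by
  let := (IsSimpleRing.isField_center R).toField
  obtain ⟨hfirst, L, _, _, W, _, _, _, φ, b, hb, hsymm, hadj⟩ := h
  have hW : n = Module.finrank L W :=
    Nat.pow_left_injective two_ne_zero (hn.symm.trans (finrank_eq_sq_of_algEquiv_end φ))
  let s := invoLinearMap σ (Subring.center R) hfirst.center_eq_symCenter.le
  have hs : IsAdjointInvo (fun a => φ (1 ⊗ₜ a)) s b ε := ⟨hb, hsymm, hadj⟩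
  rw [skewDim_eq_finrank_ker hfirst.center_eq_symCenter, hW]
  exact hs.two_mul_finrank_ker_add_one (isAntiInvolution_app σ).involutive

theorem IsFirstKind.orthogonal_or_symplectic {σ : RingInvo R} (h : IsFirstKind σ) :
    IsOrthogonalType σ ∨ IsSymplecticType σ := by
  let := (IsSimpleRing.isField_center R).toField
  have := isCentral_center R
  let L := AlgebraicClosure (Subring.center R)
  obtain ⟨n, hn, ⟨φ⟩⟩ := exists_algEquiv_end_of_isAlgClosed (Z := Subring.center R) (A := R) L
  have : NeZero n := ⟨hn.ne'⟩
  obtain ⟨b, ε, hε, hb⟩ := exists_isAdjointInvo_of_algEquiv_end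
    (isAntiInvolution_invoLinearMap σ _ h.center_eq_symCenter.le) φ
  have hadj : IsAdjointOfSign σ ε :=
    ⟨h, L, _, _, Fin n → L, _, _, inferInstance, φ, b, hb.nondegenerate, hb.symm, hb.adjoint⟩
  rcases hε with rfl | rfl
  · exact Or.inl hadj
  · exact Or.inr hadj

theorem orthogonal_or_symplectic_or_unitary (σ : RingInvo R) :
    IsOrthogonalType σ ∨ IsSymplecticType σ ∨ IsUnitaryType σ := by
  by_cases h : IsFirstKind σ
  · exact h.orthogonal_or_symplectic.imp_right Or.inl
  · exact Or.inr (Or.inr h)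

theorem type_iff_skewDim [CharZero R] (σ : RingInvo R) {n : ℕ} (hn0 : 0 < n)
    (hn : centerDim R = n ^ 2) :
    (IsOrthogonalType σ ↔ skewDim σ = n * (n - 1) / 2) ∧
      (IsSymplecticType σ ↔ skewDim σ = n * (n + 1) / 2 ∧ Even n) ∧
      (IsUnitaryType σ ↔ skewDim σ = n ^ 2) := by
  have hpred : 2 * (n * (n - 1) / 2) + n = n ^ 2 := by
    rw [Nat.two_mul_div_two_of_even (Nat.even_mul_pred_self n), Nat.mul_sub_one, sq]
    exact Nat.sub_add_cancel (Nat.le_mul_self n)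
  have hsucc : 2 * (n * (n + 1) / 2) = n ^ 2 + n := by
    rw [Nat.two_mul_div_two_of_even (Nat.even_mul_succ_self n), mul_add_one, sq]
  have hsq (heven : Even n) : n < n ^ 2 :=
    lt_self_pow₀ (Nat.one_lt_of_ne_zero_of_even hn0.ne' heven) one_lt_two
  have hO (h : IsOrthogonalType σ) : skewDim σ = n * (n - 1) / 2 := by
    have hdim : 2 * skewDim σ + n = n ^ 2 := by
      zify
      linarith [IsAdjointOfSign.two_mul_skewDim h hn]
    omega
  have hS (h : IsSymplecticType σ) : skewDim σ = n * (n + 1) / 2 ∧ Even n := by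
    have hdim : 2 * skewDim σ = n ^ 2 + n := by
      zify
      linarith [IsAdjointOfSign.two_mul_skewDim h hn]
    exact ⟨by omega, h.even hn⟩
  have hU (h : IsUnitaryType σ) : skewDim σ = n ^ 2 := h.skewDim_eq.trans hn
  have htype := orthogonal_or_symplectic_or_unitary σ
  grind

end SimpleInvolution

section Factors

open Classical in
theorem mem_factor_iff {ι : Type*} {A : ι → Type*} [∀ i, Ring (A i)] {i : ι} {x : ∀ i, A i} :
    x ∈ factor A i ↔ Pi.single i 1 * x = x := by
  have hmul : Pi.single i 1 * x = Pi.single i (x i) := by rw [← Pi.single_mul_left, one_mul]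
  rw [hmul]
  exact ⟨single_apply_of_mem_factor, fun h => h ▸ single_mem_factor i (x i)⟩

open Classical in
theorem single_one_mul_comm {ι : Type*} {A : ι → Type*} [∀ i, Ring (A i)] (i : ι)
    (x : ∀ i, A i) : Pi.single i 1 * x = x * Pi.single i 1 := by
  rw [← Pi.single_mul_left, ← Pi.single_mul_right, one_mul, mul_one]

variable {ι : Type*} {A : ι → Type*} [∀ i, Ring (A i)] {s : RingInvo (∀ i, A i)}

open Classical in
theorem app_mem_factor {i j : ι} (h : app s (Pi.single i 1) = Pi.single j 1) {x : ∀ i, A i}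
    (hx : x ∈ factor A i) : app s x ∈ factor A j := by
  rw [mem_factor_iff, single_one_mul_comm, ← h, ← app_mul, mem_factor_iff.1 hx]

open Classical in
theorem maps_of_app_single_one {i j : ι} (h : app s (Pi.single i 1) = Pi.single j 1) :
    Maps s i j := by
  have h' : app s (Pi.single j 1) = Pi.single i 1 := by rw [← h, app_app]
  refine Set.Subset.antisymm ?_ fun y hy => ⟨app s y, app_mem_factor h' hy, app_app s y⟩
  rintro _ ⟨x, hx, rfl⟩
  exact app_mem_factor h hx

theorem Maps.eq_right [∀ i, Nontrivial (A i)] {i j k : ι} (h : Maps s i j) (h' : Maps s i k) :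
    j = k := by
  classical
  have hm : (Pi.single j 1 : ∀ i, A i) ∈ factor A k := h' ▸ h ▸ single_mem_factor j 1
  by_contra hjk
  simpa using hm j hjk

theorem eq_zero_or_one_of_mem_center {R : Type*} [Ring R] [IsSimpleRing R] {e : R}
    (he : e ∈ Subring.center R) (hee : IsIdempotentElem e) : e = 0 ∨ e = 1 := by
  let := (IsSimpleRing.isField_center R).toField
  have hcenter : IsIdempotentElem (⟨e, he⟩ : Subring.center R) := Subtype.ext hee
  exact (IsIdempotentElem.iff_eq_zero_or_one.1 hcenter).imp (congrArg Subtype.val)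
    (congrArg Subtype.val)

open Classical in
theorem app_single_one_apply [∀ i, IsSimpleRing (A i)] (s : RingInvo (∀ i, A i)) (i j : ι) :
    app s (Pi.single i 1) j = 0 ∨ app s (Pi.single i 1) j = 1 := by
  have hcentral : app s (Pi.single i 1) ∈ Subring.center (∀ i, A i) :=
    app_mem_center s (Subring.mem_center_iff.2 fun x => (single_one_mul_comm i x).symm)
  refine eq_zero_or_one_of_mem_center (Subring.mem_center_iff.2 fun a => ?_) ?_
  · simpa using congrFun (Subring.mem_center_iff.1 hcentral (Pi.single j a)) j
  · change (app s (Pi.single i 1) * app s (Pi.single i 1)) j = _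
    rw [← app_mul, ← Pi.single_mul, one_mul]

theorem existsUnique_maps [∀ i, IsSimpleRing (A i)] (s : RingInvo (∀ i, A i)) (i : ι) :
    ∃! j, Maps s i j := by
  classical
  have happ_ne (k : ι) : app s (Pi.single k 1) ≠ 0 := fun h0 => by
    have hk := app_app s (Pi.single k 1)
    rw [h0, app_zero] at hk
    simpa using (congrFun hk k).symm
  obtain ⟨j, hj⟩ := Function.ne_iff.1 (happ_ne i)
  have hj_one := (app_single_one_apply s i j).resolve_left hj
  have hmul : Pi.single j 1 * app s (Pi.single i 1) = Pi.single j 1 := by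
    rw [← Pi.single_mul_left, hj_one, one_mul]
  have hsupp : app s (Pi.single j 1) = Pi.single i (app s (Pi.single j 1) i) := by
    conv_lhs => rw [← hmul, app_mul, app_app, ← Pi.single_mul_left, one_mul]
  have hi_ne : app s (Pi.single j 1) i ≠ 0 := fun h0 =>
    happ_ne j (by rw [hsupp, h0, Pi.single_zero])
  rw [(app_single_one_apply s j i).resolve_left hi_ne] at hsupp
  exact ⟨j, (maps_of_app_single_one hsupp).symm,
    fun k hk => hk.eq_right (maps_of_app_single_one hsupp).symm⟩

open Classical in
/-- The map between two factors induced by an involution of the product. It is the restriction of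
`s` when `Maps s i j`. -/
noncomputable def factorMap (s : RingInvo (∀ i, A i)) (i j : ι) : A i →+ A j where
  toFun a := app s (Pi.single i a) j
  map_zero' := by simp [app_zero]
  map_add' a b := by simp [Pi.single_add, app_add]

theorem factorMap_mul (i j : ι) (a b : A i) :
    factorMap s i j (a * b) = factorMap s i j b * factorMap s i j a := by
  simp [factorMap, Pi.single_mul, app_mul]

theorem app_blockInvo {i : ι} (h : Maps s i i) (a : A i) :
    app (blockInvo s h) a = factorMap s i i a := rfl

theorem app_pairInvo {i j : ι} (h : Maps s i j) (a : A i × A j) :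
    app (pairInvo s h) a = (factorMap s j i a.2, factorMap s i j a.1) := rfl

namespace Maps

theorem app_apply {i j : ι} (h : Maps s i j) (x : ∀ i, A i) :
    app s x j = factorMap s i j (x i) := by
  classical
  let y := app s (Pi.single j 1)
  have hy : app s y = Pi.single j 1 := app_app s _
  have hyi : Pi.single i (y i) = y :=
    single_apply_of_mem_factor (h.symm.mem (single_mem_factor j 1))
  have hmul : x * y = Pi.single i (x i) * y := by
    rw [← hyi, ← Pi.single_mul_right, ← Pi.single_mul]
  calc app s x j = (app s y * app s x) j := by simp [hy]
    _ = (app s y * app s (Pi.single i (x i))) j := by rw [← app_mul, hmul, app_mul]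
    _ = factorMap s i j (x i) := by simp [hy, factorMap]

theorem factorMap_factorMap {i j : ι} (h : Maps s i j) (a : A i) :
    factorMap s j i (factorMap s i j a) = a := by
  classical
  have happ := h.symm.app_apply (app s (Pi.single i a))
  rw [app_app, Pi.single_eq_same] at happ
  exact happ.symm

theorem factorMap_mem_center {i j : ι} (h : Maps s i j) {z : A i}
    (hz : z ∈ Subring.center (A i)) : factorMap s i j z ∈ Subring.center (A j) :=
  Subring.mem_center_iff.2 fun b => by
    rw [← h.symm.factorMap_factorMap b, ← factorMap_mul, ← factorMap_mul,
      Subring.mem_center_iff.1 hz]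

/-- The isomorphism of a factor with the opposite of its image under the involution. -/
noncomputable def ringEquivOp {i j : ι} (h : Maps s i j) : A j ≃+* (A i)ᵐᵒᵖ where
  toFun b := MulOpposite.op (factorMap s j i b)
  invFun a := factorMap s i j a.unop
  left_inv b := h.symm.factorMap_factorMap b
  right_inv a := by simp [h.factorMap_factorMap]
  map_mul' a b := by simp [factorMap_mul]
  map_add' a b := by simp

theorem mem_symCenter_pairInvo_iff {i j : ι} (h : Maps s i j) {z : A i × A j} :
    z ∈ symCenter (pairInvo s h) ↔ z.1 ∈ Subring.center (A i) ∧ z.2 = factorMap s i j z.1 := by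
  change z ∈ Subring.center (A i × A j) ∧ app (pairInvo s h) z = z ↔ _
  rw [Subring.center_prod, Subring.mem_prod, app_pairInvo, Prod.ext_iff]
  constructor
  · rintro ⟨⟨hz, -⟩, -, hsnd⟩
    exact ⟨hz, hsnd.symm⟩
  · rintro ⟨hz, hsnd⟩
    exact ⟨⟨hz, hsnd ▸ h.factorMap_mem_center hz⟩, by simp [hsnd, h.factorMap_factorMap], hsnd.symm⟩

theorem app_pairInvo_eq_neg_iff {i j : ι} (h : Maps s i j) {z : A i × A j} :
    app (pairInvo s h) z = -z ↔ z.2 = -factorMap s i j z.1 := by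
  rw [app_pairInvo, Prod.ext_iff]
  constructor
  · rintro ⟨-, hsnd⟩
    exact (neg_eq_iff_eq_neg.2 hsnd).symm
  · intro hsnd
    simp [hsnd, h.factorMap_factorMap]

theorem bijOn_fst_symCenter {i j : ι} (h : Maps s i j) :
    Set.BijOn Prod.fst {z | z ∈ symCenter (pairInvo s h)} {z | z ∈ Subring.center (A i)} := by
  refine ⟨fun z hz => (h.mem_symCenter_pairInvo_iff.1 hz).1, fun z hz w hw hzw => ?_,
    fun a ha => ⟨(a, factorMap s i j a), h.mem_symCenter_pairInvo_iff.2 ⟨ha, rfl⟩, rfl⟩⟩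
  refine Prod.ext hzw ?_
  rw [(h.mem_symCenter_pairInvo_iff.1 hz).2, (h.mem_symCenter_pairInvo_iff.1 hw).2, hzw]

/-- The projection of the skew elements of two exchanged factors to the first factor. -/
noncomputable def skewPairAddEquiv {i j : ι} (h : Maps s i j) :
    skewModule (pairInvo s h) ≃+ A i where
  toFun x := x.1.1
  invFun a := ⟨(a, -factorMap s i j a), h.app_pairInvo_eq_neg_iff.2 rfl⟩
  left_inv x := Subtype.ext (Prod.ext rfl (h.app_pairInvo_eq_neg_iff.1 x.2).symm)
  right_inv _ := rfl
  map_add' _ _ := rfl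

/-- The projection `Maps.skewPairAddEquiv` as an isomorphism of Lie algebras. -/
noncomputable def skewPairLieEquiv [∀ i, Algebra ℚ (A i)] {i j : ι} (h : Maps s i j) :
    skew (pairInvo s h) ≃ₗ⁅ℚ⁆ A i where
  toFun := h.skewPairAddEquiv
  invFun := h.skewPairAddEquiv.symm
  left_inv := h.skewPairAddEquiv.left_inv
  right_inv := h.skewPairAddEquiv.right_inv
  map_add' _ _ := rfl
  map_smul' _ _ := rfl
  map_lie' := rfl

theorem skewDim_pairInvo {i j : ι} (h : Maps s i j) :
    skewDim (pairInvo s h) = centerDim (A i) := by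
  have hrank := lift_rank_eq_of_equiv_equiv
    (Set.MapsTo.restrict _ _ _ h.bijOn_fst_symCenter.mapsTo :
      symCenter (pairInvo s h) → Subring.center (A i)) h.skewPairAddEquiv
    h.bijOn_fst_symCenter.bijective fun _ _ => rfl
  simpa [skewDim, centerDim, Module.finrank] using congrArg Cardinal.toNat hrank

end Maps

theorem centerDim_eq_of_ringEquiv_op {R S : Type*} [Ring R] [Ring S] (e : S ≃+* Rᵐᵒᵖ) :
    centerDim S = centerDim R := by
  let ec : Subring.center S ≃+* Subring.center R :=
    (Subring.centerCongr e).trans Subring.centerToMulOpposite.symm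
  have hrank := lift_rank_eq_of_equiv_equiv ec
    (e.toAddEquiv.trans MulOpposite.opAddEquiv.symm) ec.bijective fun c x =>
      (congrArg MulOpposite.unop (map_mul e (c : S) x)).trans
        (Subring.mem_center_iff.1 (ec c).2 _)
  simpa [centerDim, Module.finrank] using congrArg Cardinal.toNat hrank

end Factors

section Wedderburn

theorem isSimpleRing_end (K V : Type*) [DivisionRing K] [AddCommGroup V] [Module K V]
    [Module.Finite K V] [Nontrivial V] : IsSimpleRing (Module.End K V) := by
  let n := Module.finrank K V
  have : Nonempty (Fin n) := Fin.pos_iff_nonempty.1 Module.finrank_pos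
  let toMatrix := (Module.finBasis K V).equivFun.conjRingEquiv.trans
    (endVecRingEquivMatrixEnd (Fin n) K K)
  have : IsSimpleRing (Module.End K K) :=
    IsSimpleRing.of_ringEquiv (RingEquiv.moduleEndSelf K) inferInstance
  exact IsSimpleRing.of_ringEquiv toMatrix.symm inferInstance

theorem finite_center_of_algebra (k R : Type*) [CommRing k] [Ring R] [Algebra k R]
    [Module.Finite k R] : Module.Finite (Subring.center R) R :=
  Module.Finite.of_restrictScalars_finite k (Subalgebra.center k R) R

theorem finite_center_of_surjective {R S : Type*} [Ring R] [Ring S]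
    [Module.Finite (Subring.center R) R] (f : R →+* S) (hf : Function.Surjective f) :
    Module.Finite (Subring.center S) S := by
  have hcenter (z : Subring.center R) : f z ∈ Subring.center S :=
    Subring.mem_center_iff.2 <| hf.forall.2 fun x => by
      rw [← map_mul, ← map_mul, Subring.mem_center_iff.1 z.2]
  let φ : Subring.center R →+* Subring.center S :=
    (f.comp (Subring.center R).subtype).codRestrict _ hcenter
  let := Module.compHom S φ
  let := Module.compHom (Subring.center S) φ
  have : IsScalarTower (Subring.center R) (Subring.center S) S :=
    ⟨fun z c x => mul_assoc (f z) (c : S) x⟩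
  let fLinear : R →ₗ[Subring.center R] S :=
    { toFun := f, map_add' := map_add f, map_smul' := fun z x => map_mul f (z : R) x }
  have := Module.Finite.of_surjective fLinear hf
  exact Module.Finite.of_restrictScalars_finite (Subring.center R) _ S

variable {R : Type u} [Ring R]

theorem finite_moduleEnd (M : Type*) [AddCommGroup M] [Module R M]
    [Module.Finite (Subring.center R) R] [Module.Finite R M] :
    Module.Finite (Module.End R M) M := by
  have : Module.Finite (Subring.center R) M := Module.Finite.trans R M
  exact Module.Finite.of_restrictScalars_finite (Subring.center R) _ M

theorem isSimpleRing_endD (V : Type*) [AddCommGroup V] [Module R V]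
    [Module.Finite (Subring.center R) R] [IsSimpleModule R V] : IsSimpleRing (EndD R V) := by
  classical
  have := IsSimpleModule.nontrivial R V
  have := finite_moduleEnd (R := R) V
  exact isSimpleRing_end (D R V) V

variable {ι : Type*} {V : ι → Type u} [∀ i, AddCommGroup (V i)] [∀ i, Module R (V i)]

/-- The action of `R` on a family of modules. -/
def actionHom (R : Type u) [Ring R] {ι : Type*} (V : ι → Type u) [∀ i, AddCommGroup (V i)]
    [∀ i, Module R (V i)] : R →+* ∀ i, EndD R (V i) :=
  RingHom.pi fun i => Module.toModuleEnd (D R (V i)) (S := R) (V i)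

theorem actionHom_apply (r : R) (i : ι) (v : V i) : actionHom R V r i v = r • v := rfl

namespace IsCompleteListOfSimples

protected theorem finite [IsSemisimpleRing R] (hV : IsCompleteListOfSimples R V) :
    Finite ι := by
  have := hV.simple
  choose I equivI using fun i =>
    IsSemisimpleRing.exists_linearEquiv_ideal_of_isSimpleModule R (V i)
  have hI i : IsSimpleModule R (I i) := IsSimpleModule.congr (equivI i).some.symm
  let component (i : ι) : isotypicComponents R R := ⟨isotypicComponent R R (I i), I i, hI i, rfl⟩
  refine Finite.of_injective component fun i j hij => ?_
  have hle : I i ≤ isotypicComponent R R (I j) :=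
    (I i).le_isotypicComponent.trans (congrArg Subtype.val hij).le
  obtain ⟨e⟩ := isIsotypicOfType_submodule_iff.1 (.isotypicComponent R R (I j)) _ hle
  exact hV.eq_of_iso i j ⟨(equivI i).some.trans (e.trans (equivI j).some.symm)⟩

theorem actionHom_injective [IsSemisimpleRing R] (hV : IsCompleteListOfSimples R V) :
    Function.Injective (actionHom R V) := by
  refine (injective_iff_map_eq_zero _).2 fun r hr => ?_
  have hsimple (I : Submodule R R) (hI : IsSimpleModule R I) (x : I) : r • x = 0 := by
    obtain ⟨i, ⟨e⟩⟩ := hV.complete I hI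
    exact e.injective (by rw [map_smul, ← actionHom_apply, hr, map_zero]; rfl)
  suffices ∀ x ∈ sSup {I : Submodule R R | IsSimpleModule R I}, r * x = 0 by
    rw [IsSemisimpleModule.sSup_simples_eq_top] at this
    simpa using this 1 trivial
  intro x hx
  rw [sSup_eq_iSup'] at hx
  induction hx using Submodule.iSup_induction' with
  | mem I x hx => exact congrArg Subtype.val (hsimple I.1 I.2 ⟨x, hx⟩)
  | zero => exact mul_zero r
  | add x y _ _ hx hy => rw [mul_add, hx, hy, add_zero]

theorem linearMap_eq_zero (hV : IsCompleteListOfSimples R V) {i j : ι} (hij : i ≠ j)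
    (f : V i →ₗ[R] V j) : f = 0 := by
  have := hV.simple
  exact f.bijective_or_eq_zero.resolve_left fun hf =>
    hij (hV.eq_of_iso i j ⟨LinearEquiv.ofBijective f hf⟩)

open Classical in
theorem end_pi_apply [Finite ι] (hV : IsCompleteListOfSimples R V)
    (g : Module.End R (∀ i, V i)) (m : ∀ i, V i) (i : ι) :
    g m i = (LinearMap.proj i ∘ₗ g ∘ₗ LinearMap.single R V i : D R (V i)) (m i) := by
  have := Fintype.ofFinite ι
  conv_lhs => rw [← Finset.univ_sum_single m, map_sum, Finset.sum_apply]
  refine Finset.sum_eq_single i (fun j _ hji => ?_) (by simp)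
  exact LinearMap.congr_fun
    (hV.linearMap_eq_zero hji (LinearMap.proj i ∘ₗ g ∘ₗ LinearMap.single R V j)) (m j)

theorem actionHom_surjective [IsSemisimpleRing R] [Module.Finite (Subring.center R) R]
    (hV : IsCompleteListOfSimples R V) : Function.Surjective (actionHom R V) := by
  classical
  intro f
  have := hV.finite
  have := hV.simple
  have := finite_moduleEnd (R := R) (∀ i, V i)
  let F : Module.End (Module.End R (∀ i, V i)) (∀ i, V i) :=
    { toFun m i := f i (m i)
      map_add' m m' := by ext i; simp
      map_smul' g m := by
        ext i
        simp only [Module.End.smul_def, RingHom.id_apply, hV.end_pi_apply g]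
        exact (f i).map_smul _ (m i) }
  obtain ⟨r, hr⟩ := Module.Finite.toModuleEnd_moduleEnd_surjective F
  refine ⟨r, funext fun i => LinearMap.ext fun v => ?_⟩
  simpa [F, actionHom_apply] using congrFun (LinearMap.congr_fun hr (Pi.single i v)) i

/-- The Wedderburn decomposition of a semisimple rational algebra, given by the action on its
simple modules. -/
noncomputable def algEquiv [IsSemisimpleRing R] [Algebra ℚ R] [Module.Finite (Subring.center R) R]
    [∀ i, Module ℚ (V i)] [∀ i, IsScalarTower ℚ R (V i)] (hV : IsCompleteListOfSimples R V) :
    R ≃ₐ[ℚ] ∀ i, EndD R (V i) :=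
  AlgEquiv.ofBijective (actionHom R V).toRatAlgHom
    ⟨hV.actionHom_injective, hV.actionHom_surjective⟩

theorem finite_center_endD [IsSemisimpleRing R] [Module.Finite (Subring.center R) R]
    (hV : IsCompleteListOfSimples R V) (i : ι) :
    Module.Finite (Subring.center (EndD R (V i))) (EndD R (V i)) :=
  finite_center_of_surjective ((Pi.evalRingHom _ i).comp (actionHom R V))
    ((Function.surjective_eval i).comp hV.actionHom_surjective)

end IsCompleteListOfSimples

end Wedderburn

section Types

theorem IsOrthogonalType.not_isSymplecticType {R : Type u} [Ring R] [IsSimpleRing R] [CharZero R]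
    [Module.Finite (Subring.center R) R] {σ : RingInvo R} (h : IsOrthogonalType σ) :
    ¬ IsSymplecticType σ := fun hS => by
  obtain ⟨n, hn0, hn⟩ := exists_centerDim_eq_sq R
  have hdimO := IsAdjointOfSign.two_mul_skewDim h hn
  have hdimS := IsAdjointOfSign.two_mul_skewDim hS hn
  omega

variable {ι : Type*} {A : ι → Type u} [∀ i, Ring (A i)] {s : RingInvo (∀ i, A i)}

namespace Maps

theorem mem_orthogonalSet_iff {i : ι} (h : Maps s i i) :
    i ∈ orthogonalSet s ↔ IsOrthogonalType (blockInvo s h) :=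
  ⟨fun hi => hi.2, fun hO => ⟨h, hO⟩⟩

theorem mem_symplecticSet_iff {i : ι} (h : Maps s i i) :
    i ∈ symplecticSet s ↔ IsSymplecticType (blockInvo s h) :=
  ⟨fun hi => hi.2, fun hS => ⟨h, hS⟩⟩

theorem mem_unitarySet_iff {i : ι} (h : Maps s i i) :
    i ∈ unitarySet s ↔ IsUnitaryType (blockInvo s h) :=
  ⟨fun hi => hi.2, fun hU => ⟨h, hU⟩⟩

variable [∀ i, IsSimpleRing (A i)] [∀ i, Module.Finite (Subring.center (A i)) (A i)]

theorem mem_orthogonalSet_or_symplecticSet_or_unitarySet {i : ι} (h : Maps s i i) :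
    i ∈ orthogonalSet s ∨ i ∈ symplecticSet s ∨ i ∈ unitarySet s := by
  rw [h.mem_orthogonalSet_iff, h.mem_symplecticSet_iff, h.mem_unitarySet_iff]
  exact orthogonal_or_symplectic_or_unitary _

end Maps

theorem disjoint_orthogonalSet_symplecticSet [∀ i, IsSimpleRing (A i)] [∀ i, CharZero (A i)]
    [∀ i, Module.Finite (Subring.center (A i)) (A i)] :
    Disjoint (orthogonalSet s) (symplecticSet s) :=
  Set.disjoint_left.2 fun _ ⟨_, hO⟩ ⟨_, hS⟩ => hO.not_isSymplecticType hS

theorem disjoint_orthogonalSet_unitarySet : Disjoint (orthogonalSet s) (unitarySet s) :=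
  Set.disjoint_left.2 fun _ ⟨_, hO⟩ ⟨_, hU⟩ => hU hO.1

theorem disjoint_symplecticSet_unitarySet : Disjoint (symplecticSet s) (unitarySet s) :=
  Set.disjoint_left.2 fun _ ⟨_, hS⟩ ⟨_, hU⟩ => hU hS.1

/-- The index of the factor underlying each orthogonal, symplectic or unitary summand, and of the
first and of the second factor of each exchanged pair. -/
def componentIndex (s : RingInvo (∀ i, A i)) (T : Set ι) :
    orthogonalSet s ⊕ symplecticSet s ⊕ unitarySet s ⊕ exchangedPairs s T ⊕ exchangedPairs s T →
      ι :=
  Sum.elim (↑) <| Sum.elim (↑) <| Sum.elim (↑) <| Sum.elim (fun p => p.1.1) fun p => p.1.2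

variable {T : Set ι} [∀ i, IsSimpleRing (A i)]

theorem injective_sumElim_exchangedPairs (hT : SelectsOne s T) :
    Function.Injective
      (Sum.elim (fun p : exchangedPairs s T => p.1.1) fun p : exchangedPairs s T => p.1.2) := by
  refine Function.Injective.sumElim ?_ ?_ ?_
  · rintro ⟨⟨i, j⟩, -, -, h⟩ ⟨⟨_, k⟩, -, -, h'⟩ rfl
    exact Subtype.ext (Prod.ext rfl (h.eq_right h'))
  · rintro ⟨⟨j, i⟩, -, -, h⟩ ⟨⟨k, _⟩, -, -, h'⟩ rfl
    exact Subtype.ext (Prod.ext (h.symm.eq_right h'.symm) rfl)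
  · rintro ⟨⟨i, j⟩, hi, -, -⟩ ⟨⟨k, l⟩, hk, hne, h⟩ (hil : i = l)
    exact (hT k l hne h).elim (fun hkl => hkl.2 (hil ▸ hi)) fun hlk => hlk.2 hk

theorem Maps.ne_sumElim_exchangedPairs {i : ι} (h : Maps s i i)
    (p : exchangedPairs s T ⊕ exchangedPairs s T) :
    i ≠ Sum.elim (fun p => p.1.1) (fun p => p.1.2) p := by
  rcases p with ⟨p, -, hne, hp⟩ | ⟨p, -, hne, hp⟩ <;> rintro rfl
  · exact hne (h.eq_right hp)
  · exact hne (hp.symm.eq_right h)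

variable [∀ i, Module.Finite (Subring.center (A i)) (A i)]

theorem componentIndex_surjective (hT : SelectsOne s T) :
    Function.Surjective (componentIndex s T) := fun i => by
  obtain ⟨j, h, -⟩ := existsUnique_maps s i
  obtain rfl | hij := eq_or_ne i j
  · rcases h.mem_orthogonalSet_or_symplecticSet_or_unitarySet with hi | hi | hi
    · exact ⟨.inl ⟨i, hi⟩, rfl⟩
    · exact ⟨.inr (.inl ⟨i, hi⟩), rfl⟩
    · exact ⟨.inr (.inr (.inl ⟨i, hi⟩)), rfl⟩
  · rcases hT i j hij h with ⟨hi, -⟩ | ⟨hj, -⟩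
    · exact ⟨.inr (.inr (.inr (.inl ⟨(i, j), hi, hij, h⟩))), rfl⟩
    · exact ⟨.inr (.inr (.inr (.inr ⟨(j, i), hj, hij.symm, h.symm⟩))), rfl⟩

theorem componentIndex_injective [∀ i, CharZero (A i)] (hT : SelectsOne s T) :
    Function.Injective (componentIndex s T) := by
  refine Subtype.val_injective.sumElim (Subtype.val_injective.sumElim
    (Subtype.val_injective.sumElim (injective_sumElim_exchangedPairs hT) ?_) ?_) ?_
  · rintro ⟨i, h, -⟩ p
    exact h.ne_sumElim_exchangedPairs p
  · rintro ⟨i, hi⟩ (⟨j, hj⟩ | p)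
    · exact disjoint_symplecticSet_unitarySet.ne_of_mem hi hj
    · exact hi.1.ne_sumElim_exchangedPairs p
  · rintro ⟨i, hi⟩ (⟨j, hj⟩ | ⟨j, hj⟩ | p)
    · exact disjoint_orthogonalSet_symplecticSet.ne_of_mem hi hj
    · exact disjoint_orthogonalSet_unitarySet.ne_of_mem hi hj
    · exact hi.1.ne_sumElim_exchangedPairs p

end Types

section LieDecomposition

/-- The Lie algebra homomorphism to a finite direct sum with given components. -/
noncomputable def directSumLieHom {k L ι : Type*} [CommRing k] [LieRing L] [LieAlgebra k L]
    [Finite ι] {M : ι → Type*} [∀ i, LieRing (M i)] [∀ i, LieAlgebra k (M i)]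
    (f : ∀ i, L →ₗ⁅k⁆ M i) : L →ₗ⁅k⁆ ⨁ i, M i :=
  let := Fintype.ofFinite ι
  let toDirectSum (m : ∀ i, M i) : ⨁ i, M i := DFinsupp.equivFunOnFintype.symm m
  { toFun x := toDirectSum fun i => f i x
    map_add' x y := DFinsupp.ext fun i => map_add (f i) x y
    map_smul' c x := DFinsupp.ext fun i => map_smul (f i) c x
    map_lie' {x y} := DFinsupp.ext fun i => ((f i).map_lie x y).trans
      (DirectSum.bracket_apply M (toDirectSum fun i => f i x) (toDirectSum fun i => f i y) i).symm }

theorem app_transport {R S : Type*} [Ring R] [Ring S] (e : R ≃+* S) (σ : RingInvo R) (x : R) :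
    app (transport e σ) (e x) = e (app σ x) := by
  change e (app σ (e.symm (e x))) = _
  rw [e.symm_apply_apply]

/-- The isomorphism `e` restricted to the skew elements of an involution and of its transport. -/
def skewTransport {R S : Type*} [Ring R] [Ring S] [Algebra ℚ R] [Algebra ℚ S] (e : R ≃ₐ[ℚ] S)
    (σ : RingInvo R) : skew σ ≃ₗ⁅ℚ⁆ skew (transport e.toRingEquiv σ) :=
  e.toLieEquiv.ofSubalgebras _ _ <| by
    have happ (x : R) : app (transport e.toRingEquiv σ) (e x) = -e x ↔ app σ x = -x := by
      rw [← map_neg, ← e.injective.eq_iff]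
      exact Eq.congr_left (app_transport e.toRingEquiv σ x)
    ext y
    rw [LieSubalgebra.mem_map]
    constructor
    · rintro ⟨x, hx, rfl⟩
      exact (happ x).2 hx
    · exact fun hy => ⟨e.symm y, (happ _).1 (by rwa [e.apply_symm_apply]), e.apply_symm_apply y⟩

/-- An algebra homomorphism compatible with involutions, restricted to skew elements. -/
def skewHom {R S : Type*} [Ring R] [Ring S] [Algebra ℚ R] [Algebra ℚ S] (f : R →ₐ[ℚ] S)
    {σ : RingInvo R} {τ : RingInvo S} (h : ∀ x, app σ x = -x → app τ (f x) = -f x) :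
    skew σ →ₗ⁅ℚ⁆ skew τ :=
  { (f.toLinearMap ∘ₗ (skew σ).toSubmodule.subtype).codRestrict (skew τ).toSubmodule
      fun x => h x x.2 with
    map_lie' {x y} := Subtype.ext (f.toLieHom.map_lie x.1 y.1) }

section

variable {ι : Type*} {A : ι → Type*} [∀ i, Ring (A i)] {s : RingInvo (∀ i, A i)}

theorem app_eq_neg_iff [∀ i, IsSimpleRing (A i)] {x : ∀ i, A i} :
    app s x = -x ↔ ∀ i j, Maps s i j → x j = -factorMap s i j (x i) := by
  constructor
  · intro hx i j h
    rw [← h.app_apply, hx, Pi.neg_apply, neg_neg]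
  · refine fun hx => funext fun j => ?_
    obtain ⟨i, h, -⟩ := existsUnique_maps s j
    rw [h.symm.app_apply, Pi.neg_apply, hx i j h.symm, neg_neg]

theorem app_eq_neg_of_components [∀ i, IsSimpleRing (A i)] {T : Set ι} (hT : SelectsOne s T)
    {y : ∀ i, A i} (hstable : ∀ i (h : Maps s i i), app (blockInvo s h) (y i) = -y i)
    (hpair : ∀ p : exchangedPairs s T,
      app (pairInvo s p.2.2.2) (y p.1.1, y p.1.2) = -(y p.1.1, y p.1.2)) :
    app s y = -y := by
  refine app_eq_neg_iff.2 fun i j h => ?_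
  obtain rfl | hij := eq_or_ne i j
  · rw [← app_blockInvo h, hstable i h, neg_neg]
  · rcases hT i j hij h with ⟨hi, -⟩ | ⟨hj, -⟩
    · exact h.app_pairInvo_eq_neg_iff.1 (hpair ⟨(i, j), hi, hij, h⟩)
    · have hp := congrArg Prod.fst (hpair ⟨(j, i), hj, hij.symm, h.symm⟩)
      exact (neg_eq_iff_eq_neg.2 hp).symm

variable [∀ i, Algebra ℚ (A i)] [∀ i, IsSimpleRing (A i)]

/-- The projection of the skew elements to a stable factor. -/
noncomputable def skewToBlock {i : ι} (h : Maps s i i) : skew s →ₗ⁅ℚ⁆ skew (blockInvo s h) :=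
  skewHom (Pi.evalAlgHom ℚ A i) fun x hx => by
    rw [app_blockInvo]
    exact neg_eq_iff_eq_neg.1 (app_eq_neg_iff.1 hx i i h).symm

/-- The projection of the skew elements to a pair of exchanged factors. -/
noncomputable def skewToPair {i j : ι} (h : Maps s i j) : skew s →ₗ⁅ℚ⁆ skew (pairInvo s h) :=
  skewHom ((Pi.evalAlgHom ℚ A i).prod (Pi.evalAlgHom ℚ A j)) fun _ hx =>
    h.app_pairInvo_eq_neg_iff.2 (app_eq_neg_iff.1 hx i j h)

end

variable {ι : Type*} {A : ι → Type u} [∀ i, Ring (A i)] [∀ i, Algebra ℚ (A i)]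
  [∀ i, IsSimpleRing (A i)] {s : RingInvo (∀ i, A i)} {T : Set ι} [Finite ι]

/-- The projections of the skew elements to the stable factors of each type and to the exchanged
pairs of factors. -/
noncomputable def skewComponents (s : RingInvo (∀ i, A i)) (T : Set ι) : skew s →ₗ⁅ℚ⁆
    (⨁ i : orthogonalSet s, skew (blockInvo s i.2.choose)) ×
    (⨁ i : symplecticSet s, skew (blockInvo s i.2.choose)) ×
    (⨁ i : unitarySet s, skew (blockInvo s i.2.choose)) ×
    (⨁ p : exchangedPairs s T, skew (pairInvo s p.2.2.2)) :=
  LieHom.prod (directSumLieHom fun i => skewToBlock i.2.choose) <|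
  LieHom.prod (directSumLieHom fun i => skewToBlock i.2.choose) <|
  LieHom.prod (directSumLieHom fun i => skewToBlock i.2.choose)
    (directSumLieHom fun p => skewToPair p.2.2.2)

theorem skewComponents_apply (x : skew s) :
    (∀ i, ((skewComponents s T x).1 i).1 = x.1 i) ∧
    (∀ i, ((skewComponents s T x).2.1 i).1 = x.1 i) ∧
    (∀ i, ((skewComponents s T x).2.2.1 i).1 = x.1 i) ∧
    (∀ p, ((skewComponents s T x).2.2.2 p).1 = (x.1 p.1.1, x.1 p.1.2)) :=
  ⟨fun _ => rfl, fun _ => rfl, fun _ => rfl, fun _ => rfl⟩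

variable [∀ i, Module.Finite (Subring.center (A i)) (A i)]

theorem skewComponents_injective (hT : SelectsOne s T) :
    Function.Injective (skewComponents s T) := by
  intro x y hxy
  obtain ⟨hxO, hxS, hxU, hxP⟩ := skewComponents_apply (T := T) x
  obtain ⟨hyO, hyS, hyU, hyP⟩ := skewComponents_apply (T := T) y
  rw [hxy] at hxO hxS hxU hxP
  refine Subtype.ext (funext fun i => ?_)
  obtain ⟨i | i | i | p | p, rfl⟩ := componentIndex_surjective hT i
  · exact (hxO i).symm.trans (hyO i)
  · exact (hxS i).symm.trans (hyS i)
  · exact (hxU i).symm.trans (hyU i)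
  · exact congrArg Prod.fst ((hxP p).symm.trans (hyP p))
  · exact congrArg Prod.snd ((hxP p).symm.trans (hyP p))

theorem skewComponents_surjective (hT : SelectsOne s T) :
    Function.Surjective (skewComponents s T) := by
  rintro ⟨o, p, u, q⟩
  have (i : ι) : CharZero (A i) := algebraRat.charZero (A i)
  let index := Equiv.ofBijective _ ⟨componentIndex_injective hT, componentIndex_surjective hT⟩
  let component : ∀ c, A (index c) :=
    Sum.rec (fun i => (o i).1) <| Sum.rec (fun i => (p i).1) <| Sum.rec (fun i => (u i).1) <|
    Sum.rec (fun i => (q i).1.1) fun i => (q i).1.2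
  let y : ∀ i, A i := index.piCongrLeft A component
  have hy (c) : y (index c) = component c := index.piCongrLeft_apply_apply A component c
  have hyO (i : orthogonalSet s) : y i = o i := hy (.inl i)
  have hyS (i : symplecticSet s) : y i = p i := hy (.inr (.inl i))
  have hyU (i : unitarySet s) : y i = u i := hy (.inr (.inr (.inl i)))
  have hyP (i : exchangedPairs s T) : (y i.1.1, y i.1.2) = (q i).1 :=
    Prod.ext (hy (.inr (.inr (.inr (.inl i))))) (hy (.inr (.inr (.inr (.inr i)))))
  have hskew : app s y = -y := by
    refine app_eq_neg_of_components hT (fun i h => ?_) fun i => by rw [hyP]; exact (q i).2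
    rcases h.mem_orthogonalSet_or_symplecticSet_or_unitarySet with hi | hi | hi
    · rw [hyO ⟨i, hi⟩]; exact (o ⟨i, hi⟩).2
    · rw [hyS ⟨i, hi⟩]; exact (p ⟨i, hi⟩).2
    · rw [hyU ⟨i, hi⟩]; exact (u ⟨i, hi⟩).2
  refine ⟨⟨y, hskew⟩, ?_⟩
  obtain ⟨hO, hS, hU, hP⟩ := skewComponents_apply (T := T) ⟨y, hskew⟩
  refine Prod.ext ?_ (Prod.ext ?_ (Prod.ext ?_ ?_)) <;>
    refine DFinsupp.ext fun i => Subtype.ext ?_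
  · exact (hO i).trans (hyO i)
  · exact (hS i).trans (hyS i)
  · exact (hU i).trans (hyU i)
  · exact (hP i).trans (hyP i)

end LieDecomposition

theorem theorem1p2_general {R : Type u} [Ring R] [IsSemisimpleRing R] [Algebra ℚ R]
    [Module.Finite (Subring.center R) R] (σ : RingInvo R) {ι : Type*} (V : ι → Type u)
    [∀ i, AddCommGroup (V i)] [∀ i, Module R (V i)] [∀ i, Module ℚ (V i)]
    [∀ i, IsScalarTower ℚ R (V i)] (hV : IsCompleteListOfSimples R V) :
    Finite ι ∧
    ∃ Φ : R ≃ₐ[ℚ] (∀ i, EndD R (V i)),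
      (∀ x i v, Φ x i v = x • v) ∧
    ∃ n : ι → ℕ,
      (∀ i, 0 < n i ∧ IsSimpleRing (EndD R (V i)) ∧ centerDim (EndD R (V i)) = n i ^ 2) ∧
    ∃ s : RingInvo (∀ i, EndD R (V i)),
      s = transport Φ.toRingEquiv σ ∧
      (∀ i, ∃! j, Maps s i j) ∧
      (∀ i (h : Maps s i i),
        (i ∈ orthogonalSet s ∨ i ∈ symplecticSet s ∨ i ∈ unitarySet s) ∧
        (i ∈ orthogonalSet s ↔ skewDim (blockInvo s h) = n i * (n i - 1) / 2) ∧
        (i ∈ symplecticSet s ↔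
          skewDim (blockInvo s h) = n i * (n i + 1) / 2 ∧ Even (n i)) ∧
        (i ∈ unitarySet s ↔ skewDim (blockInvo s h) = n i ^ 2)) ∧
      (∀ i j (h : Maps s i j), i ≠ j →
        n j = n i ∧
        Nonempty (EndD R (V j) ≃+* (EndD R (V i))ᵐᵒᵖ) ∧
        Set.BijOn Prod.fst {z | z ∈ symCenter (pairInvo s h)}
          {z | z ∈ Subring.center (EndD R (V i))} ∧
        skewDim (pairInvo s h) = n i ^ 2 ∧
        ∃ e : skew (pairInvo s h) ≃ₗ⁅ℚ⁆ EndD R (V i),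
          ∀ x, e x = (x : EndD R (V i) × EndD R (V j)).1) ∧
      ∀ T : Set ι, SelectsOne s T →
        ∃ Ψ : skew σ ≃ₗ⁅ℚ⁆
            (⨁ i : orthogonalSet s, skew (blockInvo s i.2.choose)) ×
            (⨁ i : symplecticSet s, skew (blockInvo s i.2.choose)) ×
            (⨁ i : unitarySet s, skew (blockInvo s i.2.choose)) ×
            (⨁ p : exchangedPairs s T, skew (pairInvo s p.2.2.2)),
          ∀ x : skew σ,
            (∀ i, ((Ψ x).1 i).1 = Φ x i) ∧
            (∀ i, ((Ψ x).2.1 i).1 = Φ x i) ∧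
            (∀ i, ((Ψ x).2.2.1 i).1 = Φ x i) ∧
            (∀ p, ((Ψ x).2.2.2 p).1 = (Φ x p.1.1, Φ x p.1.2)) := by
  have := hV.simple
  have := hV.finite
  have hsimple (i : ι) : IsSimpleRing (EndD R (V i)) := isSimpleRing_endD (V i)
  have := hV.finite_center_endD
  have (i : ι) : CharZero (EndD R (V i)) := algebraRat.charZero _
  choose n hn0 hn using fun i => exists_centerDim_eq_sq (EndD R (V i))
  refine ⟨hV.finite, hV.algEquiv, fun _ _ _ => rfl, n, fun i => ⟨hn0 i, hsimple i, hn i⟩,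
    transport hV.algEquiv.toRingEquiv σ, rfl, existsUnique_maps _, fun i h => ?_,
    fun i j h _ => ?_, fun T hT => ?_⟩
  · refine ⟨h.mem_orthogonalSet_or_symplecticSet_or_unitarySet, ?_⟩
    rw [h.mem_orthogonalSet_iff, h.mem_symplecticSet_iff, h.mem_unitarySet_iff]
    exact type_iff_skewDim _ (hn0 i) (hn i)
  · have hdim : n j ^ 2 = n i ^ 2 := by
      rw [← hn, ← hn, centerDim_eq_of_ringEquiv_op h.ringEquivOp]
    exact ⟨Nat.pow_left_injective two_ne_zero hdim, ⟨h.ringEquivOp⟩, h.bijOn_fst_symCenter,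
      h.skewDim_pairInvo.trans (hn i), h.skewPairLieEquiv, fun _ => rfl⟩
  · let components := LieEquiv.ofBijective (skewComponents _ T)
      ⟨skewComponents_injective hT, skewComponents_surjective hT⟩
    exact ⟨(skewTransport hV.algEquiv σ).trans components,
      fun x => skewComponents_apply (skewTransport hV.algEquiv σ x)⟩

end SkewGroupAlgebra

open SkewGroupAlgebra in
theorem theorem1p2 {G : Type u} [Group G] [Finite G] (σ : RingInvo (MonoidAlgebra ℚ G))
    {ι : Type*} (V : ι → Type u) [∀ i, AddCommGroup (V i)]
    [∀ i, Module (MonoidAlgebra ℚ G) (V i)] [∀ i, Module ℚ (V i)]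
    [∀ i, IsScalarTower ℚ (MonoidAlgebra ℚ G) (V i)]
    (hV : IsCompleteListOfSimples (MonoidAlgebra ℚ G) V) :
    Finite ι ∧
    -- the Wedderburn decomposition, given by the action on the simple modules
    ∃ Φ : MonoidAlgebra ℚ G ≃ₐ[ℚ] (∀ i, EndD (MonoidAlgebra ℚ G) (V i)),
      (∀ x i v, Φ x i v = x • v) ∧
    -- the degree of each block over its centre
    ∃ n : ι → ℕ,
      (∀ i, 0 < n i ∧ IsSimpleRing (EndD (MonoidAlgebra ℚ G) (V i)) ∧
        centerDim (EndD (MonoidAlgebra ℚ G) (V i)) = n i ^ 2) ∧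
    ∃ s : RingInvo (∀ i, EndD (MonoidAlgebra ℚ G) (V i)),
      s = transport Φ.toRingEquiv σ ∧
      -- `σ` permutes the blocks
      (∀ i, ∃! j, Maps s i j) ∧
      -- stable blocks: type and dimension of the skew part
      (∀ i (h : Maps s i i),
        (i ∈ orthogonalSet s ∨ i ∈ symplecticSet s ∨ i ∈ unitarySet s) ∧
        (i ∈ orthogonalSet s ↔ skewDim (blockInvo s h) = n i * (n i - 1) / 2) ∧
        (i ∈ symplecticSet s ↔
          skewDim (blockInvo s h) = n i * (n i + 1) / 2 ∧ Even (n i)) ∧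
        (i ∈ unitarySet s ↔ skewDim (blockInvo s h) = n i ^ 2)) ∧
      -- exchanged pairs: degree, centre, dimension and structure of the skew part
      (∀ i j (h : Maps s i j), i ≠ j →
        n j = n i ∧
        Nonempty (EndD (MonoidAlgebra ℚ G) (V j) ≃+* (EndD (MonoidAlgebra ℚ G) (V i))ᵐᵒᵖ) ∧
        Set.BijOn Prod.fst {z | z ∈ symCenter (pairInvo s h)}
          {z | z ∈ Subring.center (EndD (MonoidAlgebra ℚ G) (V i))} ∧
        skewDim (pairInvo s h) = n i ^ 2 ∧
        ∃ e : skew (pairInvo s h) ≃ₗ⁅ℚ⁆ EndD (MonoidAlgebra ℚ G) (V i),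
          ∀ x, e x = (x : EndD (MonoidAlgebra ℚ G) (V i) × EndD (MonoidAlgebra ℚ G) (V j)).1) ∧
      -- the decomposition of the Lie algebra of skew-symmetric elements
      ∀ T : Set ι, SelectsOne s T →
        ∃ Ψ : skew σ ≃ₗ⁅ℚ⁆
            (⨁ i : orthogonalSet s, skew (blockInvo s i.2.choose)) ×
            (⨁ i : symplecticSet s, skew (blockInvo s i.2.choose)) ×
            (⨁ i : unitarySet s, skew (blockInvo s i.2.choose)) ×
            (⨁ p : exchangedPairs s T, skew (pairInvo s p.2.2.2)),
          ∀ x : skew σ,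
            (∀ i, ((Ψ x).1 i).1 = Φ x i) ∧
            (∀ i, ((Ψ x).2.1 i).1 = Φ x i) ∧
            (∀ i, ((Ψ x).2.2.1 i).1 = Φ x i) ∧
            (∀ p, ((Ψ x).2.2.2 p).1 = (Φ x p.1.1, Φ x p.1.2)) := by
  have := finite_center_of_algebra ℚ (MonoidAlgebra ℚ G)
  exact theorem1p2_general σ V hV
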